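/- Let $\Omega\subseteq\mathbb R^n$ be a nonempty connected open set and $X:\Omega\to\mathbb E^{n+1}$ a smooth immersion with smooth unit normal field $N$; let $\Sigma^n$ denote $\Omega$ with the induced metric $g$. Let $A=g^{-1}II$ be the shape operator, where $II_{ij}=\langle \partial_i\partial_jX,N\rangle$, let $h=\frac1n\operatorname{Tr}A$ be the mean curvature function, $H=hN$ the mean curvature vector field, and $\Delta$ the Laplacian of $g$, applied to the coordinates of vector-valued functions. The hypersurface is \emph{biconservative} (a BCH) if $(\Delta H)^\top=0$, \emph{CMC} if $h$ is constant, and a \emph{proper} BCH if it is biconservative and not CMC. The rank at a point is the dimension of the eigenspace of $A$ for the value $-\frac{nh}{2}$ (zero if this is not an eigenvalue); $\Sigma^n$ \emph{has rank $k$} if the rank is $k$ at every point. A point is \emph{regular} if $dh\neq0$ there. Let $\Sigma^n$ be a BCH. Then: 1. If $\Sigma^n$ has rank $0$, then it is CMC. If $\Sigma^n$ has rank $k$ for some $k$, then it is either CMC, or a proper BCH and $k=1$. Without assuming that the rank is constant: if $\Sigma^n$ is a proper BCH, then regular points exist and each of them is a limit of regular points which have a neighbourhood on which the rank is $1$. 2.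 Every regular point of $h$ has a neighbourhood that is smoothly foliated by the level sets $U_t=h^{-1}(t)$ of $h$: there is a smooth chart of it onto a product $U\times I$, with $U\subseteq\mathbb R^{n-1}$ and $I\subseteq\mathbb R$ open and connected, whose last coordinate is $h$. The neighbourhood can be chosen such that $X$ maps each of these leaves diffeomorphically onto an embedded codimension-two submanifold of $\mathbb E^{n+1}$ with flat normal bundle. 3. In the set of regular points, every integral curve of $\nabla h$ is a regular curve orthogonal to the level sets of $h$. Conversely, the velocity of every regular curve orthogonal to the level sets of $h$ is at each time a nonzero multiple of $\nabla h$; and each such curve is a curvature line with principal curvature $-\frac{nh}{2}$. 4. Let $p$ be a regular point near which the rank is constant. Then the rank at $p$ is $1$, and in every orthonormal frame of principal directions $e_1,\dots,e_n$ at $p$, with principal curvatures $\lambda_1,\dots,\lambda_n$, exactly one index $i$ satisfies $\lambda_i=-\frac{nh(p)}{2}$; for this index $e_i$ is a multiple of $\nabla h(p)$. -/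

import Mathlib

open Set Topology
open scoped Matrix ContDiff

noncomputable section

namespace Hypersurface

/-- Euclidean space `𝔼ⁿ`. -/
abbrev Euc (n : ℕ) : Type := EuclideanSpace ℝ (Fin n)

/-- The coordinate space `ℝⁿ` in which parameter domains live (only its topology and its
differentiable structure are used, the metric is always the one pulled back by an immersion). -/
abbrev Coord (n : ℕ) : Type := Fin n → ℝ

section Definitions

variable {n : ℕ}

/-- The partial derivative `∂F / ∂xᵢ`. -/
def pd {V : Type*} [NormedAddCommGroup V] [NormedSpace ℝ V]
    (i : Fin n) (F : Coord n → V) (x : Coord n) : V :=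
  fderiv ℝ F x (Pi.single i 1)

/-- `X : Ω → 𝔼ⁿ⁺¹` is a smooth immersion of a connected open set `Ω ⊆ ℝⁿ`, with smooth unit
normal field `N`. -/
structure IsHypersurface (Ω : Set (Coord n)) (X N : Coord n → Euc (n + 1)) : Prop where
  isOpen : IsOpen Ω
  isConnected : IsConnected Ω
  smooth : ContDiffOn ℝ ∞ X Ω
  immersion : ∀ x ∈ Ω, Function.Injective (fderiv ℝ X x)
  smooth_normal : ContDiffOn ℝ ∞ N Ω
  norm_normal : ∀ x ∈ Ω, ‖N x‖ = 1
  normal_orthogonal : ∀ x ∈ Ω, ∀ v : Coord n, inner ℝ (N x) (fderiv ℝ X x v) = 0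

/-- The induced metric `g(v, w)` at `x`. -/
def metric (X : Coord n → Euc (n + 1)) (x v w : Coord n) : ℝ :=
  inner ℝ (fderiv ℝ X x v) (fderiv ℝ X x w)

/-- The matrix `gᵢⱼ = ⟨X,ᵢ , X,ⱼ⟩` of the induced metric. -/
def gram (X : Coord n → Euc (n + 1)) (x : Coord n) : Matrix (Fin n) (Fin n) ℝ :=
  Matrix.of fun i j => inner ℝ (pd i X x) (pd j X x)

/-- The Laplacian of the induced metric,
`Δ F = |g|^(-1/2) ∂ⱼ (|g|^(1/2) gⁱʲ ∂ᵢ F)`, on functions with values in a vector space. -/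
def laplacian {V : Type*} [NormedAddCommGroup V] [NormedSpace ℝ V]
    (X : Coord n → Euc (n + 1)) (F : Coord n → V) (x : Coord n) : V :=
  (Real.sqrt (gram X x).det)⁻¹ •
    ∑ j, pd j (fun y => Real.sqrt (gram X y).det • ∑ i, (gram X y)⁻¹ i j • pd i F y) x

/-- The matrix `IIᵢⱼ = ⟨X,ᵢⱼ , N⟩` of the second fundamental form. -/
def secondForm (X N : Coord n → Euc (n + 1)) (x : Coord n) : Matrix (Fin n) (Fin n) ℝ :=
  Matrix.of fun i j => inner ℝ (pd i (pd j X) x) (N x)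

/-- The matrix of the shape operator `A = g⁻¹ II`, acting on the coordinates `v` of tangent
vectors `dX(v)`. -/
def shape (X N : Coord n → Euc (n + 1)) (x : Coord n) : Matrix (Fin n) (Fin n) ℝ :=
  (gram X x)⁻¹ * secondForm X N x

/-- The mean curvature function `h`, with `n h = Tr A`. -/
def meanCurv (X N : Coord n → Euc (n + 1)) (x : Coord n) : ℝ :=
  (n : ℝ)⁻¹ * (shape X N x).trace

/-- The mean curvature vector field `H = h N`. -/
def meanCurvVec (X N : Coord n → Euc (n + 1)) (x : Coord n) : Euc (n + 1) :=
  meanCurv X N x • N x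

/-- The hypersurface is biconservative: `(Δ H)ᵀ = 0`, that is, `Δ H` is orthogonal to every
tangent vector. -/
def IsBiconservative (Ω : Set (Coord n)) (X N : Coord n → Euc (n + 1)) : Prop :=
  ∀ x ∈ Ω, ∀ v : Coord n, inner ℝ (laplacian X (meanCurvVec X N) x) (fderiv ℝ X x v) = 0

/-- Constant mean curvature. -/
def IsCMC (Ω : Set (Coord n)) (X N : Coord n → Euc (n + 1)) : Prop :=
  ∃ c : ℝ, ∀ x ∈ Ω, meanCurv X N x = c

/-- A proper biconservative hypersurface: biconservative and not of constant mean curvature. -/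
def IsProperBiconservative (Ω : Set (Coord n)) (X N : Coord n → Euc (n + 1)) : Prop :=
  IsBiconservative Ω X N ∧ ¬ IsCMC Ω X N

/-- The gradient of `f` for the induced metric, in coordinates: `(∇ f)ⁱ = gⁱʲ ∂ⱼ f`. -/
def grad (X : Coord n → Euc (n + 1)) (f : Coord n → ℝ) (x : Coord n) : Coord n :=
  (gram X x)⁻¹ *ᵥ fun j => pd j f x

/-- The value `- n h / 2`. -/
def specialCurv (X N : Coord n → Euc (n + 1)) (x : Coord n) : ℝ :=
  -((n : ℝ) * meanCurv X N x) / 2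

/-- The dimension of the eigenspace of the shape operator for the value `- n h / 2` at `x`. -/
def rankAt (X N : Coord n → Euc (n + 1)) (x : Coord n) : ℕ :=
  Module.finrank ℝ
    (Module.End.eigenspace (Matrix.toLin' (shape X N x)) (specialCurv X N x))

/-- The hypersurface has rank `k`. -/
def HasRank (Ω : Set (Coord n)) (X N : Coord n → Euc (n + 1)) (k : ℕ) : Prop :=
  ∀ x ∈ Ω, rankAt X N x = k

/-- The regular points of the mean curvature function. -/
def regularSet (Ω : Set (Coord n)) (X N : Coord n → Euc (n + 1)) : Set (Coord n) :=
  {x | x ∈ Ω ∧ fderiv ℝ (meanCurv X N) x ≠ 0}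

/-- `e` is an orthonormal frame of principal directions at `x`, with principal curvatures `l`. -/
def IsPrincipalFrame (X N : Coord n → Euc (n + 1)) (x : Coord n)
    (e : Fin n → Coord n) (l : Fin n → ℝ) : Prop :=
  (∀ i j, metric X x (e i) (e j) = if i = j then 1 else 0) ∧
    ∀ i, shape X N x *ᵥ e i = l i • e i

/-- `γ` is, on `(a, b)`, an integral curve of the vector field `∇ h`. -/
def IsGradientCurve (X N : Coord n → Euc (n + 1)) (γ : ℝ → Coord n) (a b : ℝ) : Prop :=
  ∀ t ∈ Ioo a b, HasDerivAt γ (grad X (meanCurv X N) (γ t)) t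

/-- `γ` is, on `(a, b)`, a regular curve orthogonal to the level sets of `h`. -/
def IsOrthogonalCurve (X N : Coord n → Euc (n + 1)) (γ : ℝ → Coord n) (a b : ℝ) : Prop :=
  ∀ t ∈ Ioo a b, deriv γ t ≠ 0 ∧
    ∀ w : Coord n, fderiv ℝ (meanCurv X N) (γ t) w = 0 → metric X (γ t) (deriv γ t) w = 0

/-- `γ` is, on `(a, b)`, a curvature line with principal curvature `l t` at `γ t`. -/
def IsCurvatureLine (X N : Coord n → Euc (n + 1)) (γ : ℝ → Coord n) (a b : ℝ)
    (l : ℝ → ℝ) : Prop :=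
  ∀ t ∈ Ioo a b, deriv γ t ≠ 0 ∧ shape X N (γ t) *ᵥ deriv γ t = l t • deriv γ t

/-- `Y : U → 𝔼ᵏ` parametrizes an embedded submanifold of dimension `m`. -/
structure IsEmbeddedPatch {m k : ℕ} (U : Set (Coord m)) (Y : Coord m → Euc k) : Prop where
  isOpen : IsOpen U
  smooth : ContDiffOn ℝ ∞ Y U
  immersion : ∀ u ∈ U, Function.Injective (fderiv ℝ Y u)
  isEmbedding : IsEmbedding (U.domRestrict Y)

/-- The normal space at `Y u` of the submanifold parametrized by `Y`. -/
def normalSpace {m k : ℕ} (Y : Coord m → Euc k) (u : Coord m) : Submodule ℝ (Euc k) :=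
  (LinearMap.range (fderiv ℝ Y u : Coord m →ₗ[ℝ] Euc k))ᗮ

/-- The normal connection `∇^⊥_v ξ = (D_v ξ)^⊥`. -/
def normalDeriv {m k : ℕ} (Y : Coord m → Euc k) (v : Coord m) (ξ : Coord m → Euc k)
    (u : Coord m) : Euc k :=
  (normalSpace Y u).starProjection (fderiv ℝ ξ u v)

/-- The normal bundle of the submanifold parametrized by `Y` is flat: the curvature
`R^⊥(v, w) ξ = ∇^⊥_v ∇^⊥_w ξ - ∇^⊥_w ∇^⊥_v ξ` of the normal connection vanishes
(for constant, hence commuting, coordinate fields `v`, `w`). -/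
def HasFlatNormalBundle {m k : ℕ} (U : Set (Coord m)) (Y : Coord m → Euc k) : Prop :=
  ∀ ξ : Coord m → Euc k, ContDiffOn ℝ ∞ ξ U → (∀ u ∈ U, ξ u ∈ normalSpace Y u) →
    ∀ v w : Coord m, ∀ u ∈ U,
      normalDeriv Y v (normalDeriv Y w ξ) u = normalDeriv Y w (normalDeriv Y v ξ) u

/-- Near `p` the hypersurface is foliated by the level sets of `h`, and these are codimension two
submanifolds of `𝔼ⁿ⁺¹` with flat normal bundle: there is a smooth chart `φ`
around `p`, onto a product `U × I`, whose last coordinate is `h`, so that the level set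
`h = t` is there parametrized by `u ↦ φ⁻¹(u, t)`, with `u` in dimension `m = n - 1`. -/
def IsFoliatedByLevelSetsAt (Ω : Set (Coord n)) (X N : Coord n → Euc (n + 1))
    (p : Coord n) : Prop :=
  ∃ (m : ℕ) (_ : n = m + 1) (φ : OpenPartialHomeomorph (Coord n) (Coord m × ℝ))
    (U : Set (Coord m)) (I : Set ℝ),
    p ∈ φ.source ∧ φ.source ⊆ Ω ∧ φ.target = U ×ˢ I ∧
    IsOpen U ∧ IsConnected U ∧ IsOpen I ∧ IsConnected I ∧
    ContDiffOn ℝ ∞ φ φ.source ∧ ContDiffOn ℝ ∞ φ.symm φ.target ∧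
    (∀ x ∈ φ.source, (φ x).2 = meanCurv X N x) ∧
    ∀ t ∈ I, IsEmbeddedPatch U (fun u => X (φ.symm (u, t))) ∧
      HasFlatNormalBundle U (fun u => X (φ.symm (u, t)))

end Definitions

end Hypersurface

end

/-!
Let `g` be the induced metric, `A` the shape operator, `h` the mean curvature function and
`λ = - n h / 2`.

The Weingarten equation `dN(v) = - dX(A v)` and the contracted Codazzi equation give
`(Δ H)ᵀ = - 2 A ∇h - n h ∇h`, so that biconservativity says `A ∇h = λ ∇h`
(`IsHypersurface.shape_mulVec_grad`). The computation rests on the non-divergence form of the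
Laplacian, `Δ F = gⁱʲ (∂ᵢⱼ F - Γˡᵢⱼ ∂ₗ F)` (`IsHypersurface.laplacian_eq`), which comes from Jacobi's
formula for the derivative of the determinant.

Hence at every regular point of `h` the value `λ` is an eigenvalue of `A` with eigenvector `∇h`.
Suppose that its multiplicity is constant near such a point `p`. Then vectors in the eigenspace `K`
at `p` are limits of eigenvectors at nearby points, and therefore, for `v` and `w` in `K`, the
quantity `g(v, (A - λ) w)` vanishes at `p` to first order. Its derivative along `u` in `K` is
`- ⟨dX(v), D²N(u, w) + λ D²X(u, w)⟩ - dλ(u) g(v, w)`, whose first term is symmetric in `u` and `w`.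
So `dλ(u) g(v, w)` is symmetric in `u` and `w` (`IsHypersurface.codazzi_of_rankAt_const`); for
`u = ∇h` and `v = w` in `K` orthogonal to `∇h` this reads `|∇h|² |w|² = 0`. Hence `K` is spanned by
`∇h`, and the rank is one (`IsHypersurface.rankAt_eq_one`). As the rank is upper semicontinuous, it
is locally constant on an open dense set (`IsHypersurface.regularSet_subset_closure`).

Near a regular point `h` can be completed to a chart. The normal bundle of a leaf `h = t` in the
ambient space is spanned by `N` and the unit vector field along `dX(∇h)`. This frame is parallel,
since `⟨dN(v), dX(∇h)⟩ = - g(v, A ∇h) = - λ dh(v) = 0` for `v` tangent to the leaf, and so the normal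
bundle is flat (`IsHypersurface.hasFlatNormalBundle_of_levelSet`).
-/

namespace Hypersurface

variable {n : ℕ} {V : Type*} [NormedAddCommGroup V] [NormedSpace ℝ V]

/-! ### Calculus of partial derivatives -/

theorem fderiv_apply_eq_sum_pd (F : Coord n → V) (x v : Coord n) :
    fderiv ℝ F x v = ∑ i, v i • pd i F x := by
  conv_lhs => rw [← Finset.univ_sum_single v]
  rw [map_sum]
  refine Finset.sum_congr rfl fun i _ => ?_
  rw [pd, ← map_smul, ← Pi.single_smul, smul_eq_mul, mul_one]

theorem contDiffOn_pd {Ω : Set (Coord n)} (hΩ : IsOpen Ω) {F : Coord n → V}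
    (hF : ContDiffOn ℝ ∞ F Ω) (i : Fin n) : ContDiffOn ℝ ∞ (pd i F) Ω :=
  (hF.fderiv_of_isOpen hΩ (m := ∞) (by simp)).clm_apply contDiffOn_const

theorem differentiableAt_of_contDiffOn {E : Type*} [NormedAddCommGroup E] [NormedSpace ℝ E]
    {Ω : Set E} (hΩ : IsOpen Ω) {F : E → V}
    (hF : ContDiffOn ℝ ∞ F Ω) {x : E} (hx : x ∈ Ω) : DifferentiableAt ℝ F x :=
  (hF.contDiffAt (hΩ.mem_nhds hx)).differentiableAt (by simp)

theorem pd_congr {F G : Coord n → V} {x : Coord n} (h : F =ᶠ[𝓝 x] G) (i : Fin n) :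
    pd i F x = pd i G x := by
  rw [pd, pd, h.fderiv_eq]

theorem pd_congr_of_isOpen {Ω : Set (Coord n)} (hΩ : IsOpen Ω) {F G : Coord n → V}
    (h : ∀ y ∈ Ω, F y = G y) {x : Coord n} (hx : x ∈ Ω) (i : Fin n) :
    pd i F x = pd i G x :=
  pd_congr (Filter.eventually_of_mem (hΩ.mem_nhds hx) h) i

theorem pd_const (i : Fin n) (c : V) (x : Coord n) : pd i (fun _ => c) x = 0 := by
  simp [pd]

theorem pd_neg (i : Fin n) (F : Coord n → V) (x : Coord n) :
    pd i (fun y => -F y) x = -pd i F x := by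
  simp [pd, fderiv_fun_neg]

theorem pd_add {F G : Coord n → V} {x : Coord n} (hF : DifferentiableAt ℝ F x)
    (hG : DifferentiableAt ℝ G x) (i : Fin n) :
    pd i (fun y => F y + G y) x = pd i F x + pd i G x := by
  simp [pd, fderiv_fun_add hF hG]

theorem pd_sum {ι : Type*} {s : Finset ι} {F : ι → Coord n → V} {x : Coord n}
    (hF : ∀ j ∈ s, DifferentiableAt ℝ (F j) x) (i : Fin n) :
    pd i (fun y => ∑ j ∈ s, F j y) x = ∑ j ∈ s, pd i (F j) x := by
  simp [pd, fderiv_fun_sum hF]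

theorem pd_smul {f : Coord n → ℝ} {F : Coord n → V} {x : Coord n}
    (hf : DifferentiableAt ℝ f x) (hF : DifferentiableAt ℝ F x) (i : Fin n) :
    pd i (fun y => f y • F y) x = f x • pd i F x + pd i f x • F x := by
  simp [pd, fderiv_fun_smul hf hF]

theorem pd_mul {f g : Coord n → ℝ} {x : Coord n}
    (hf : DifferentiableAt ℝ f x) (hg : DifferentiableAt ℝ g x) (i : Fin n) :
    pd i (fun y => f y * g y) x = f x * pd i g x + pd i f x * g x :=
  pd_smul hf hg i

theorem pd_inner {E : Type*} [NormedAddCommGroup E] [InnerProductSpace ℝ E]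
    {F G : Coord n → E} {x : Coord n} (hF : DifferentiableAt ℝ F x)
    (hG : DifferentiableAt ℝ G x) (i : Fin n) :
    pd i (fun y => inner ℝ (F y) (G y)) x =
      inner ℝ (F x) (pd i G x) + inner ℝ (pd i F x) (G x) :=
  fderiv_inner_apply ℝ hF hG _

theorem fderiv_fderiv_comm {Ω : Set (Coord n)} (hΩ : IsOpen Ω) {F : Coord n → V}
    (hF : ContDiffOn ℝ ∞ F Ω) {x : Coord n} (hx : x ∈ Ω) (u v : Coord n) :
    fderiv ℝ (fderiv ℝ F) x u v = fderiv ℝ (fderiv ℝ F) x v u :=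
  (hF.contDiffAt (hΩ.mem_nhds hx)).isSymmSndFDerivAt (by
    rw [minSmoothness_of_isRCLikeNormedField]
    exact WithTop.coe_le_coe.2 (le_top : (2 : ℕ∞) ≤ ⊤)) u v

theorem pd_comm {Ω : Set (Coord n)} (hΩ : IsOpen Ω) {F : Coord n → V}
    (hF : ContDiffOn ℝ ∞ F Ω) {x : Coord n} (hx : x ∈ Ω) (i j : Fin n) :
    pd i (pd j F) x = pd j (pd i F) x := by
  have hd : DifferentiableAt ℝ (fderiv ℝ F) x :=
    differentiableAt_of_contDiffOn hΩ (hF.fderiv_of_isOpen hΩ (m := ∞) (by simp)) hx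
  have key : ∀ a b : Fin n, pd a (pd b F) x =
      fderiv ℝ (fderiv ℝ F) x (Pi.single a 1) (Pi.single b 1) := by
    intro a b
    rw [pd]
    have : pd b F = fun y => (fderiv ℝ F y) (Pi.single b 1) := rfl
    rw [this, fderiv_clm_apply hd (differentiableAt_const _)]
    simp
  rw [key, key]
  exact fderiv_fderiv_comm hΩ hF hx _ _

/-! ### Derivatives of matrix valued functions -/

/-- The entrywise partial derivative of a matrix valued function. -/
noncomputable def matPd {l m : Type*} (k : Fin n) (M : Coord n → Matrix l m ℝ) (x : Coord n) :
    Matrix l m ℝ :=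
  Matrix.of fun i j => pd k (fun y => M y i j) x

theorem matPd_mul {l m o : Type*} [Fintype m] {M : Coord n → Matrix l m ℝ}
    {P : Coord n → Matrix m o ℝ} {x : Coord n}
    (hM : ∀ i j, DifferentiableAt ℝ (fun y => M y i j) x)
    (hP : ∀ i j, DifferentiableAt ℝ (fun y => P y i j) x) (k : Fin n) :
    matPd k (fun y => M y * P y) x = matPd k M x * P x + M x * matPd k P x := by
  ext i j
  simp only [matPd, Matrix.of_apply, Matrix.mul_apply, Matrix.add_apply]
  rw [pd_sum (F := fun a y => M y i a * P y a j) fun a _ => (hM i a).fun_mul (hP a j),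
    ← Finset.sum_add_distrib]
  refine Finset.sum_congr rfl fun a _ => ?_
  rw [pd_mul (hM i a) (hP a j), add_comm]

theorem contDiffOn_det {m : Type*} [Fintype m] [DecidableEq m] {Ω : Set (Coord n)}
    {M : Coord n → Matrix m m ℝ} (hM : ∀ i j, ContDiffOn ℝ ∞ (fun y => M y i j) Ω) :
    ContDiffOn ℝ ∞ (fun y => (M y).det) Ω := by
  simp only [Matrix.det_apply]
  refine ContDiffOn.sum fun σ _ => ContDiffOn.const_smul _ ?_
  exact contDiffOn_prod fun i _ => hM _ _

theorem contDiffOn_matrix_inv {m : Type*} [Fintype m] [DecidableEq m] {Ω : Set (Coord n)}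
    {M : Coord n → Matrix m m ℝ} (hM : ∀ i j, ContDiffOn ℝ ∞ (fun y => M y i j) Ω)
    (hdet : ∀ y ∈ Ω, (M y).det ≠ 0) (i j : m) :
    ContDiffOn ℝ ∞ (fun y => (M y)⁻¹ i j) Ω := by
  simp only [Matrix.inv_def, Matrix.smul_apply, smul_eq_mul, Ring.inverse_eq_inv',
    Matrix.adjugate_apply]
  refine ((contDiffOn_det hM).inv hdet).mul (contDiffOn_det fun a b => ?_)
  by_cases h : a = j
  · subst h
    simpa using contDiffOn_const
  · simpa [Matrix.updateRow_ne h] using hM a b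

theorem contDiff_det (m : Type*) [Fintype m] [DecidableEq m] :
    ContDiff ℝ ∞ fun M : m → m → ℝ => (Matrix.of M).det := by
  simp only [Matrix.det_apply]
  refine ContDiff.sum fun σ _ => ContDiff.const_smul _ ?_
  refine contDiff_prod fun i _ => ?_
  exact contDiff_apply_apply ..

/-- Jacobi's formula for the derivative of the determinant at an invertible matrix. -/
theorem pd_det {m : Type*} [Fintype m] [DecidableEq m] {M : Coord n → Matrix m m ℝ}
    {x : Coord n} (hM : ∀ i j, DifferentiableAt ℝ (fun y => M y i j) x)
    (hdet : (M x).det ≠ 0) (k : Fin n) :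
    pd k (fun y => (M y).det) x = (M x).det * ((M x)⁻¹ * matPd k M x).trace := by
  set D : (m → m → ℝ) → ℝ := fun P => (Matrix.of P).det
  have hD : DifferentiableAt ℝ D (fun i j => M x i j) :=
    (contDiff_det m).contDiffAt.differentiableAt (by simp)
  set M' : m → m → ℝ := fun i j => matPd k M x i j
  have hMd : HasFDerivAt (fun y => (fun i j => M y i j : m → m → ℝ))
      (ContinuousLinearMap.pi fun i => ContinuousLinearMap.pi fun j =>
        fderiv ℝ (fun y => M y i j) x) x :=
    hasFDerivAt_pi.2 fun i => hasFDerivAt_pi.2 fun j => (hM i j).hasFDerivAt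
  have h1 : pd k (fun y => (M y).det) x = fderiv ℝ D (fun i j => M x i j) M' := by
    have := (HasFDerivAt.comp x hD.hasFDerivAt hMd).fderiv
    change fderiv ℝ (D ∘ _) x _ = _
    rw [this]
    rfl
  -- the derivative along the line through `M x` in the direction `M'`
  have hline : HasDerivAt (fun t : ℝ => (fun i j => M x i j : m → m → ℝ) + t • M') M' 0 := by
    simpa using ((hasDerivAt_id (0 : ℝ)).smul_const M').const_add (fun i j => M x i j)
  have h2 : HasDerivAt (fun t : ℝ => D ((fun i j => M x i j : m → m → ℝ) + t • M'))
      (fderiv ℝ D (fun i j => M x i j) M') 0 := by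
    refine HasFDerivAt.comp_hasDerivAt (0 : ℝ) ?_ hline
    have h0 : (fun i j => M x i j : m → m → ℝ) + (0 : ℝ) • M' = fun i j => M x i j := by simp
    rw [h0]
    exact hD.hasFDerivAt
  have h3 : ∀ t : ℝ, D ((fun i j => M x i j : m → m → ℝ) + t • M') =
      (M x).det * (1 + t • ((M x)⁻¹ * matPd k M x)).det := by
    intro t
    rw [← Matrix.det_mul, mul_add, mul_one, Matrix.mul_smul, ← mul_assoc,
      Matrix.mul_nonsing_inv _ hdet.isUnit, one_mul]
    rfl
  have h4 : HasDerivAt (fun t : ℝ => (1 + t • ((M x)⁻¹ * matPd k M x)).det)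
      ((M x)⁻¹ * matPd k M x).trace 0 := by
    set B := (M x)⁻¹ * matPd k M x
    have h5 := (Polynomial.hasDerivAt
      (Matrix.det (1 + (Polynomial.X : Polynomial ℝ) • B.map Polynomial.C)) 0)
    rw [Matrix.derivative_det_one_add_X_smul] at h5
    refine h5.congr_of_eventuallyEq (Filter.Eventually.of_forall fun t => ?_)
    simp [eval_det, ← Matrix.smul_eq_mul_diagonal]
  rw [h1]
  refine h2.unique ?_
  simp only [h3]
  exact h4.const_mul _

theorem matPd_inv {m : Type*} [Fintype m] [DecidableEq m] {Ω : Set (Coord n)} (hΩ : IsOpen Ω)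
    {M : Coord n → Matrix m m ℝ} (hM : ∀ i j, ContDiffOn ℝ ∞ (fun y => M y i j) Ω)
    (hdet : ∀ y ∈ Ω, (M y).det ≠ 0) {x : Coord n} (hx : x ∈ Ω) (k : Fin n) :
    matPd k (fun y => (M y)⁻¹) x = -((M x)⁻¹ * matPd k M x * (M x)⁻¹) := by
  have hd : ∀ i j, DifferentiableAt ℝ (fun y => M y i j) x :=
    fun i j => differentiableAt_of_contDiffOn hΩ (hM i j) hx
  have hd' : ∀ i j, DifferentiableAt ℝ (fun y => (M y)⁻¹ i j) x :=
    fun i j => differentiableAt_of_contDiffOn hΩ (contDiffOn_matrix_inv hM hdet i j) hx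
  have h1 : matPd k (fun y => M y * (M y)⁻¹) x = 0 := by
    ext i j
    simp only [matPd, Matrix.of_apply, Matrix.zero_apply]
    rw [pd_congr_of_isOpen hΩ (G := fun _ => (1 : Matrix m m ℝ) i j) _ hx, pd_const]
    intro y hy
    rw [Matrix.mul_nonsing_inv _ (hdet y hy).isUnit]
  rw [matPd_mul hd hd'] at h1
  have h2 := congrArg (fun P => (M x)⁻¹ * P) h1
  simp only [mul_add, ← mul_assoc, Matrix.nonsing_inv_mul _ (hdet x hx).isUnit, one_mul,
    mul_zero] at h2
  exact eq_neg_of_add_eq_zero_right h2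

end Hypersurface

namespace Hypersurface

variable {n : ℕ} {V : Type*} [NormedAddCommGroup V] [NormedSpace ℝ V]

/-! ### First and second fundamental forms -/

variable {Ω : Set (Coord n)} {X N : Coord n → Euc (n + 1)} {x : Coord n}

theorem gram_transpose (X : Coord n → Euc (n + 1)) (x : Coord n) : (gram X x)ᵀ = gram X x := by
  ext i j
  simp [gram, real_inner_comm]

theorem gram_inv_comm (X : Coord n → Euc (n + 1)) (x : Coord n) (i j : Fin n) :
    (gram X x)⁻¹ i j = (gram X x)⁻¹ j i := by
  conv_rhs => rw [← gram_transpose, ← Matrix.transpose_nonsing_inv]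
  rfl

theorem IsHypersurface.gram_det_pos (hX : IsHypersurface Ω X N) (hx : x ∈ Ω) :
    0 < (gram X x).det := by
  have hli : LinearIndependent ℝ fun i : Fin n => pd i X x := by
    have h := (Pi.basisFun ℝ (Fin n)).linearIndependent.map'
      (fderiv ℝ X x : Coord n →ₗ[ℝ] Euc (n + 1))
      (LinearMap.ker_eq_bot.2 (hX.immersion x hx))
    have e : (fderiv ℝ X x : Coord n →ₗ[ℝ] Euc (n + 1)) ∘ Pi.basisFun ℝ (Fin n) =
        fun i => pd i X x := by
      ext i : 1
      simp [pd]
    rw [e] at h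
    exact h
  exact (Matrix.posDef_gram_of_linearIndependent (𝕜 := ℝ) hli).det_pos

theorem IsHypersurface.gram_mul_inv (hX : IsHypersurface Ω X N) (hx : x ∈ Ω) :
    gram X x * (gram X x)⁻¹ = 1 :=
  Matrix.mul_nonsing_inv _ (hX.gram_det_pos hx).ne'.isUnit

theorem IsHypersurface.gram_inv_mul (hX : IsHypersurface Ω X N) (hx : x ∈ Ω) :
    (gram X x)⁻¹ * gram X x = 1 :=
  Matrix.nonsing_inv_mul _ (hX.gram_det_pos hx).ne'.isUnit

theorem IsHypersurface.contDiffOn_pd (hX : IsHypersurface Ω X N) (i : Fin n) :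
    ContDiffOn ℝ ∞ (pd i X) Ω :=
  Hypersurface.contDiffOn_pd hX.isOpen hX.smooth i

theorem IsHypersurface.contDiffOn_gram (hX : IsHypersurface Ω X N) (i j : Fin n) :
    ContDiffOn ℝ ∞ (fun y => gram X y i j) Ω :=
  (hX.contDiffOn_pd i).inner ℝ (hX.contDiffOn_pd j)

theorem IsHypersurface.contDiffOn_gram_inv (hX : IsHypersurface Ω X N) (i j : Fin n) :
    ContDiffOn ℝ ∞ (fun y => (gram X y)⁻¹ i j) Ω :=
  contDiffOn_matrix_inv hX.contDiffOn_gram (fun _ hy => (hX.gram_det_pos hy).ne') i j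

theorem IsHypersurface.contDiffOn_secondForm (hX : IsHypersurface Ω X N) (i j : Fin n) :
    ContDiffOn ℝ ∞ (fun y => secondForm X N y i j) Ω :=
  (Hypersurface.contDiffOn_pd hX.isOpen (hX.contDiffOn_pd j) i).inner ℝ hX.smooth_normal

theorem IsHypersurface.contDiffOn_shape (hX : IsHypersurface Ω X N) (i j : Fin n) :
    ContDiffOn ℝ ∞ (fun y => shape X N y i j) Ω := by
  simp only [shape, Matrix.mul_apply]
  exact ContDiffOn.sum fun a _ =>
    (hX.contDiffOn_gram_inv i a).mul (hX.contDiffOn_secondForm a j)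

theorem IsHypersurface.contDiffOn_meanCurv (hX : IsHypersurface Ω X N) :
    ContDiffOn ℝ ∞ (meanCurv X N) Ω := by
  have : ContDiffOn ℝ ∞ (fun y => (n : ℝ)⁻¹ * ∑ i, shape X N y i i) Ω :=
    contDiffOn_const.mul (ContDiffOn.sum fun i _ => hX.contDiffOn_shape i i)
  exact this

theorem metric_eq_dotProduct (X : Coord n → Euc (n + 1)) (x v w : Coord n) :
    metric X x v w = v ⬝ᵥ gram X x *ᵥ w := by
  rw [metric, fderiv_apply_eq_sum_pd, fderiv_apply_eq_sum_pd, sum_inner]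
  simp only [dotProduct, Matrix.mulVec, gram, Matrix.of_apply]
  refine Finset.sum_congr rfl fun i _ => ?_
  rw [inner_sum, Finset.mul_sum]
  refine Finset.sum_congr rfl fun j _ => ?_
  rw [real_inner_smul_left, real_inner_smul_right]
  ring

theorem IsHypersurface.metric_pos (hX : IsHypersurface Ω X N) (hx : x ∈ Ω) {v : Coord n}
    (hv : v ≠ 0) : 0 < metric X x v v := by
  rw [metric, real_inner_self_eq_norm_sq]
  have : fderiv ℝ X x v ≠ 0 := fun h => hv (hX.immersion x hx (by simpa using h))
  positivity

theorem metric_comm (X : Coord n → Euc (n + 1)) (x v w : Coord n) :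
    metric X x v w = metric X x w v :=
  real_inner_comm _ _

theorem IsHypersurface.exists_metric_sub_smul_eq_zero (hX : IsHypersurface Ω X N) (hx : x ∈ Ω)
    {u : Coord n} (hu : u ≠ 0) (v : Coord n) : ∃ c : ℝ, metric X x u (v - c • u) = 0 := by
  have huu := hX.metric_pos hx hu
  refine ⟨metric X x u v / metric X x u u, ?_⟩
  simp only [metric] at huu ⊢
  rw [map_sub, map_smul, inner_sub_right, real_inner_smul_right, div_mul_cancel₀ _ huu.ne',
    sub_self]

theorem IsHypersurface.metric_grad (hX : IsHypersurface Ω X N) (hx : x ∈ Ω)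
    (f : Coord n → ℝ) (v : Coord n) : metric X x (grad X f x) v = fderiv ℝ f x v := by
  rw [metric_comm, metric_eq_dotProduct, grad, Matrix.mulVec_mulVec, hX.gram_mul_inv hx,
    Matrix.one_mulVec, fderiv_apply_eq_sum_pd]
  rfl

theorem IsHypersurface.grad_ne_zero (hX : IsHypersurface Ω X N) (hx : x ∈ Ω)
    {f : Coord n → ℝ} (hf : fderiv ℝ f x ≠ 0) : grad X f x ≠ 0 := by
  intro h
  apply hf
  ext v
  rw [← hX.metric_grad hx, h, metric]
  simp

/-- A vector orthogonal to the tangent space and to the normal vanishes. -/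
theorem IsHypersurface.eq_zero_of_inner_eq_zero (hX : IsHypersurface Ω X N) (hx : x ∈ Ω)
    {z : Euc (n + 1)} (hz : ∀ k, inner ℝ z (pd k X x) = 0) (hzN : inner ℝ z (N x) = 0) :
    z = 0 := by
  set K : Submodule ℝ (Euc (n + 1)) :=
    LinearMap.range (fderiv ℝ X x : Coord n →ₗ[ℝ] Euc (n + 1)) with hK
  have hKdim : Module.finrank ℝ K = n := by
    rw [hK, LinearMap.finrank_range_of_inj (hX.immersion x hx)]
    simp
  have hKo : Module.finrank ℝ Kᗮ = 1 := by
    have := K.finrank_add_finrank_orthogonal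
    rw [hKdim, finrank_euclideanSpace, Fintype.card_fin] at this
    omega
  have hNK : N x ∈ Kᗮ := by
    rw [Submodule.mem_orthogonal']
    rintro _ ⟨v, rfl⟩
    exact hX.normal_orthogonal x hx v
  have hzK : z ∈ Kᗮ := by
    rw [Submodule.mem_orthogonal']
    rintro _ ⟨v, rfl⟩
    rw [ContinuousLinearMap.coe_coe, fderiv_apply_eq_sum_pd, inner_sum]
    exact Finset.sum_eq_zero fun k _ => by rw [real_inner_smul_right, hz, mul_zero]
  have hN1 := hX.norm_normal x hx
  have hN0 : (⟨N x, hNK⟩ : Kᗮ) ≠ 0 := by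
    intro h
    have : N x = 0 := congrArg Subtype.val h
    rw [this] at hN1
    simp at hN1
  obtain ⟨c, hc⟩ := (finrank_eq_one_iff_of_nonzero' _ hN0).1 hKo ⟨z, hzK⟩
  have hc' : c • N x = z := congrArg Subtype.val hc
  rw [← hc', real_inner_smul_left, real_inner_self_eq_norm_sq, hN1] at hzN
  rw [← hc', show c = 0 by linarith, zero_smul]

theorem IsHypersurface.inner_pd_normal (hX : IsHypersurface Ω X N) (hx : x ∈ Ω) (i : Fin n) :
    inner ℝ (pd i X x) (N x) = 0 := by
  rw [real_inner_comm]
  exact hX.normal_orthogonal x hx _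

theorem IsHypersurface.inner_pd_normal_normal (hX : IsHypersurface Ω X N) (hx : x ∈ Ω)
    (i : Fin n) : inner ℝ (pd i N x) (N x) = 0 := by
  have hN := differentiableAt_of_contDiffOn hX.isOpen hX.smooth_normal hx
  have h1 := pd_inner hN hN i
  rw [pd_congr_of_isOpen hX.isOpen (G := fun _ => (1 : ℝ)) _ hx, pd_const,
    real_inner_comm] at h1
  · linarith
  · intro y hy
    rw [real_inner_self_eq_norm_sq, hX.norm_normal y hy, one_pow]

theorem IsHypersurface.secondForm_comm (hX : IsHypersurface Ω X N) (hx : x ∈ Ω) (i j : Fin n) :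
    secondForm X N x i j = secondForm X N x j i := by
  simp only [secondForm, Matrix.of_apply]
  rw [pd_comm hX.isOpen hX.smooth hx]

theorem IsHypersurface.secondForm_eq (hX : IsHypersurface Ω X N) (hx : x ∈ Ω) (i j : Fin n) :
    secondForm X N x i j = -inner ℝ (pd i X x) (pd j N x) := by
  have hN := differentiableAt_of_contDiffOn hX.isOpen hX.smooth_normal hx
  have hXi := differentiableAt_of_contDiffOn hX.isOpen (hX.contDiffOn_pd i) hx
  have h1 := pd_inner hXi hN j
  rw [pd_congr_of_isOpen hX.isOpen (G := fun _ => (0 : ℝ))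
    (fun y hy => hX.inner_pd_normal hy i) hx, pd_const] at h1
  rw [hX.secondForm_comm hx]
  simp only [secondForm, Matrix.of_apply]
  linarith

theorem IsHypersurface.gram_mul_shape (hX : IsHypersurface Ω X N) (hx : x ∈ Ω) :
    gram X x * shape X N x = secondForm X N x := by
  rw [shape, ← mul_assoc, hX.gram_mul_inv hx, one_mul]

/-- The Weingarten equation `∂ᵢ N = - Aˡᵢ ∂ₗ X`. -/
theorem IsHypersurface.pd_normal (hX : IsHypersurface Ω X N) (hx : x ∈ Ω) (i : Fin n) :
    pd i N x = -∑ l, shape X N x l i • pd l X x := by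
  rw [← sub_eq_zero, sub_neg_eq_add]
  refine hX.eq_zero_of_inner_eq_zero hx (fun k => ?_) ?_
  · rw [inner_add_left, sum_inner, real_inner_comm, ← neg_eq_iff_eq_neg.2 (hX.secondForm_eq hx k i),
      ← hX.gram_mul_shape hx, Matrix.mul_apply, neg_add_eq_zero]
    refine Finset.sum_congr rfl fun l _ => ?_
    rw [real_inner_smul_left, real_inner_comm, mul_comm]
    rfl
  · rw [inner_add_left, hX.inner_pd_normal_normal hx, sum_inner, zero_add]
    exact Finset.sum_eq_zero fun l _ => by
      rw [real_inner_smul_left, hX.inner_pd_normal hx, mul_zero]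

/-- The Weingarten equation `dN(v) = - dX(A v)`. -/
theorem IsHypersurface.fderiv_normal (hX : IsHypersurface Ω X N) (hx : x ∈ Ω) (v : Coord n) :
    fderiv ℝ N x v = -fderiv ℝ X x (shape X N x *ᵥ v) := by
  rw [fderiv_apply_eq_sum_pd, fderiv_apply_eq_sum_pd]
  simp only [hX.pd_normal hx, smul_neg, Finset.sum_neg_distrib, Finset.smul_sum,
    Matrix.mulVec, dotProduct, Finset.sum_smul]
  rw [Finset.sum_comm]
  simp only [smul_smul, mul_comm]

/-- The shape operator is self-adjoint for the induced metric. -/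
theorem IsHypersurface.metric_shape (hX : IsHypersurface Ω X N) (hx : x ∈ Ω) (v w : Coord n) :
    metric X x (shape X N x *ᵥ v) w = metric X x v (shape X N x *ᵥ w) := by
  have hsym : (secondForm X N x)ᵀ = secondForm X N x := by
    ext i j
    exact hX.secondForm_comm hx j i
  rw [metric_comm, metric_eq_dotProduct, metric_eq_dotProduct, Matrix.mulVec_mulVec,
    Matrix.mulVec_mulVec, hX.gram_mul_shape hx, ← Matrix.vecMul_transpose, hsym,
    Matrix.dotProduct_mulVec, dotProduct_comm]

end Hypersurface

namespace Hypersurface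

variable {n : ℕ} {V : Type*} [NormedAddCommGroup V] [NormedSpace ℝ V]

/-! ### The tangential part of the Laplacian of the mean curvature vector -/

variable {Ω : Set (Coord n)} {X N : Coord n → Euc (n + 1)} {x : Coord n}

/-- The derivative of the Gram matrix is the symmetrised Christoffel symbol of the first kind. -/
theorem IsHypersurface.matPd_gram (hX : IsHypersurface Ω X N) (hx : x ∈ Ω) (k i j : Fin n) :
    matPd k (gram X) x i j =
      inner ℝ (pd k (pd i X) x) (pd j X x) + inner ℝ (pd k (pd j X) x) (pd i X x) := by
  have hd : ∀ a, DifferentiableAt ℝ (pd a X) x := fun a =>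
    differentiableAt_of_contDiffOn hX.isOpen (hX.contDiffOn_pd a) hx
  have := pd_inner (hd i) (hd j) k
  rw [real_inner_comm (pd i X x), add_comm, ← this]
  rfl

/-- The index computation that turns the divergence form of the Laplacian into
`gⁱʲ (∂ᵢⱼ - Γˡᵢⱼ ∂ₗ)`. -/
theorem sum_christoffel_identity (G : Matrix (Fin n) (Fin n) ℝ) (Γ : Fin n → Fin n → Fin n → ℝ)
    (hG : ∀ i j, G i j = G j i) (hΓ : ∀ i j k, Γ i j k = Γ j i k) (i : Fin n) :
    ∑ j, (-(∑ b, (∑ a, G i a * (Γ j a b + Γ j b a)) * G b j) +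
      (2⁻¹ * ∑ a, ∑ b, G a b * (Γ j b a + Γ j a b)) * G i j) =
      -∑ a, G i a * ∑ b, ∑ j, G b j * Γ j b a := by
  have h1 : ∀ j, ∑ b, (∑ a, G i a * (Γ j a b + Γ j b a)) * G b j =
      ∑ a, ∑ b, G i a * Γ j a b * G b j + ∑ a, ∑ b, G i a * Γ j b a * G b j := by
    intro j
    rw [← Finset.sum_add_distrib]
    simp only [Finset.sum_mul]
    rw [Finset.sum_comm]
    refine Finset.sum_congr rfl fun a _ => ?_
    rw [← Finset.sum_add_distrib]
    exact Finset.sum_congr rfl fun b _ => by ring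
  have h2 : ∀ j, (2⁻¹ * ∑ a, ∑ b, G a b * (Γ j b a + Γ j a b)) * G i j =
      ∑ a, ∑ b, G i j * Γ j a b * G b a := by
    intro j
    have h3 : ∑ a, ∑ b, G a b * Γ j b a = ∑ a, ∑ b, G a b * Γ j a b := by
      rw [Finset.sum_comm]
      exact Finset.sum_congr rfl fun a _ => Finset.sum_congr rfl fun b _ => by rw [hG]
    simp only [mul_add, Finset.sum_add_distrib, h3]
    rw [← mul_add, ← two_mul, ← mul_assoc, inv_mul_cancel₀ two_ne_zero, one_mul, Finset.sum_mul]
    refine Finset.sum_congr rfl fun a _ => ?_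
    rw [Finset.sum_mul]
    exact Finset.sum_congr rfl fun b _ => by rw [hG a b]; ring
  have h4 : ∑ j, ∑ a, ∑ b, G i a * Γ j a b * G b j = ∑ j, ∑ a, ∑ b, G i j * Γ j a b * G b a := by
    rw [Finset.sum_comm]
    exact Finset.sum_congr rfl fun a _ => Finset.sum_congr rfl fun j _ =>
      Finset.sum_congr rfl fun b _ => by rw [hΓ]
  rw [Finset.sum_add_distrib, Finset.sum_neg_distrib]
  simp only [h1, h2]
  rw [Finset.sum_add_distrib, h4]
  have h5 : ∑ j, ∑ a, ∑ b, G i a * Γ j b a * G b j = ∑ a, G i a * ∑ b, ∑ j, G b j * Γ j b a := by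
    rw [Finset.sum_comm]
    refine Finset.sum_congr rfl fun a _ => ?_
    rw [Finset.sum_comm, Finset.mul_sum]
    refine Finset.sum_congr rfl fun b _ => ?_
    rw [Finset.mul_sum]
    exact Finset.sum_congr rfl fun j _ => by ring
  rw [h5]
  ring

/-- The contraction `gⁱʲ ∂ᵢⱼ X`. -/
noncomputable def hessTrace (X : Coord n → Euc (n + 1)) (x : Coord n) : Euc (n + 1) :=
  ∑ b, ∑ j, (gram X x)⁻¹ b j • pd j (pd b X) x

/-- The coordinates of the tangential part of `gⁱʲ ∂ᵢⱼ X`, that is, the contraction `gⁱʲ Γˡᵢⱼ` of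
the Christoffel symbols. -/
noncomputable def christoffelTrace (X : Coord n → Euc (n + 1)) (x : Coord n) (i : Fin n) : ℝ :=
  ∑ a, (gram X x)⁻¹ i a * inner ℝ (hessTrace X x) (pd a X x)

theorem IsHypersurface.pd_sqrt_det (hX : IsHypersurface Ω X N) (hx : x ∈ Ω) (j : Fin n) :
    pd j (fun y => Real.sqrt (gram X y).det) x = Real.sqrt (gram X x).det *
      (2⁻¹ * ((gram X x)⁻¹ * matPd j (gram X) x).trace) := by
  have hg : ∀ a b, DifferentiableAt ℝ (fun y => gram X y a b) x := fun a b =>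
    differentiableAt_of_contDiffOn hX.isOpen (hX.contDiffOn_gram a b) hx
  have hdet := hX.gram_det_pos hx
  have hd : DifferentiableAt ℝ (fun y => (gram X y).det) x :=
    differentiableAt_of_contDiffOn hX.isOpen (contDiffOn_det hX.contDiffOn_gram) hx
  have h1 : pd j (fun y => Real.sqrt (gram X y).det) x =
      (1 / (2 * Real.sqrt (gram X x).det)) * pd j (fun y => (gram X y).det) x := by
    rw [pd, fderiv_sqrt hd hdet.ne']
    rfl
  rw [h1, pd_det hg hdet.ne']
  have hs : Real.sqrt (gram X x).det ≠ 0 := (Real.sqrt_pos.2 hdet).ne'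
  conv_lhs => enter [2, 1]; rw [← Real.mul_self_sqrt hdet.le]
  field_simp

/-- The Laplacian in non-divergence form, `Δ F = gⁱʲ (∂ᵢⱼ F - Γˡᵢⱼ ∂ₗ F)`. -/
theorem IsHypersurface.laplacian_eq (hX : IsHypersurface Ω X N) {F : Coord n → V}
    (hF : ContDiffOn ℝ ∞ F Ω) (hx : x ∈ Ω) :
    laplacian X F x = ∑ i, ∑ j, (gram X x)⁻¹ i j • pd j (pd i F) x -
      ∑ i, christoffelTrace X x i • pd i F x := by
  have hdet := hX.gram_det_pos hx
  have hs : Real.sqrt (gram X x).det ≠ 0 := (Real.sqrt_pos.2 hdet).ne'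
  have hsd : DifferentiableAt ℝ (fun y => Real.sqrt (gram X y).det) x :=
    (differentiableAt_of_contDiffOn hX.isOpen (contDiffOn_det hX.contDiffOn_gram) hx).sqrt hdet.ne'
  have hGd : ∀ i j, DifferentiableAt ℝ (fun y => (gram X y)⁻¹ i j) x := fun i j =>
    differentiableAt_of_contDiffOn hX.isOpen (hX.contDiffOn_gram_inv i j) hx
  have hFd : ∀ i, DifferentiableAt ℝ (pd i F) x := fun i =>
    differentiableAt_of_contDiffOn hX.isOpen (Hypersurface.contDiffOn_pd hX.isOpen hF i) hx
  have hGF : ∀ i j, DifferentiableAt ℝ (fun y => (gram X y)⁻¹ i j • pd i F y) x := fun i j =>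
    (hGd i j).smul (hFd i)
  set G := (gram X x)⁻¹ with hG
  have h1 : ∀ j, pd j (fun y => Real.sqrt (gram X y).det •
      ∑ i, (gram X y)⁻¹ i j • pd i F y) x = Real.sqrt (gram X x).det •
      ∑ i, (G i j • pd j (pd i F) x + (matPd j (fun y => (gram X y)⁻¹) x i j +
        (2⁻¹ * (G * matPd j (gram X) x).trace) * G i j) • pd i F x) := by
    intro j
    rw [pd_smul hsd (DifferentiableAt.fun_sum fun i _ => hGF i j), pd_sum fun i _ => hGF i j,
      hX.pd_sqrt_det hx, mul_smul, ← smul_add, Finset.smul_sum, ← Finset.sum_add_distrib]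
    congr 1
    refine Finset.sum_congr rfl fun i _ => ?_
    rw [pd_smul (hGd i j) (hFd i), add_smul, smul_smul, ← add_assoc]
    rfl
  rw [laplacian]
  simp only [h1]
  rw [← Finset.smul_sum, smul_smul, inv_mul_cancel₀ hs, one_smul, Finset.sum_comm]
  simp only [Finset.sum_add_distrib]
  rw [sub_eq_add_neg, ← Finset.sum_neg_distrib]
  congr 1
  refine Finset.sum_congr rfl fun i _ => ?_
  rw [← Finset.sum_smul, ← neg_smul]
  congr 1
  have h2 := sum_christoffel_identity G
    (fun i j k => inner ℝ (pd i (pd j X) x) (pd k X x)) (fun i j => gram_inv_comm X x i j)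
    (fun i j k => by rw [pd_comm hX.isOpen hX.smooth hx]) i
  simp only [christoffelTrace, hessTrace, sum_inner, real_inner_smul_left]
  rw [← hG, ← h2]
  refine Finset.sum_congr rfl fun j _ => ?_
  rw [matPd_inv hX.isOpen hX.contDiffOn_gram (fun y hy => (hX.gram_det_pos hy).ne') hx]
  simp only [Matrix.neg_apply, Matrix.mul_apply, Matrix.trace, Matrix.diag_apply,
    hX.matPd_gram hx]
  rfl

/-- `tr (g⁻¹ ∂ₖg A) = - 2 gⁱʲ ⟨∂ᵢₖ X, ∂ⱼ N⟩`. -/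
theorem IsHypersurface.trace_inv_mul_matPd_gram_mul_shape (hX : IsHypersurface Ω X N)
    (hx : x ∈ Ω) (k : Fin n) :
    ((gram X x)⁻¹ * matPd k (gram X) x * shape X N x).trace =
      -2 * ∑ i, ∑ j, (gram X x)⁻¹ i j * inner ℝ (pd k (pd i X) x) (pd j N x) := by
  set G := (gram X x)⁻¹ with hG
  set P : Matrix (Fin n) (Fin n) ℝ := Matrix.of fun i j => inner ℝ (pd k (pd i X) x) (pd j X x)
  have hP : matPd k (gram X) x = P + Pᵀ := by
    ext i j
    rw [hX.matPd_gram hx]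
    rfl
  have hGt : Gᵀ = G := by
    ext i j
    exact gram_inv_comm X x j i
  have hIIt : (secondForm X N x)ᵀ = secondForm X N x := by
    ext i j
    exact hX.secondForm_comm hx j i
  have h1 : (G * Pᵀ * shape X N x).trace = (G * P * shape X N x).trace := by
    rw [← Matrix.trace_transpose, shape, ← hG]
    simp only [Matrix.transpose_mul, Matrix.transpose_transpose, hGt, hIIt]
    rw [Matrix.mul_assoc, Matrix.trace_mul_comm]
    simp only [Matrix.mul_assoc]
  rw [hP, mul_add, add_mul, Matrix.trace_add, h1, ← two_mul]
  rw [neg_mul, ← mul_neg]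
  congr 1
  rw [Matrix.mul_assoc, Matrix.trace]
  simp only [Matrix.diag_apply, Matrix.mul_apply, hX.pd_normal hx, inner_neg_right, inner_sum,
    real_inner_smul_right]
  rw [Finset.sum_comm]
  simp only [mul_neg, Finset.sum_neg_distrib, neg_neg]
  refine Finset.sum_congr rfl fun i _ => Finset.sum_congr rfl fun j _ => ?_
  rw [show G j i = G i j from gram_inv_comm X x j i]
  congr 1
  exact Finset.sum_congr rfl fun l _ => mul_comm _ _

theorem card_mul_meanCurv (X N : Coord n → Euc (n + 1)) (x : Coord n) :
    n * meanCurv X N x = (shape X N x).trace := by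
  rcases Nat.eq_zero_or_pos n with h | h
  · subst h
    simp [Matrix.trace]
  · rw [meanCurv, ← mul_assoc, mul_inv_cancel₀ (by exact_mod_cast h.ne'), one_mul]

/-- `n ∂ₖ h = gⁱʲ (⟨∂ₖᵢ X, ∂ⱼ N⟩ - ⟨∂ᵢ X, ∂ₖⱼ N⟩)`. -/
theorem IsHypersurface.card_mul_pd_meanCurv (hX : IsHypersurface Ω X N) (hx : x ∈ Ω)
    (k : Fin n) :
    n * pd k (meanCurv X N) x = ∑ i, ∑ j, (gram X x)⁻¹ i j *
      (inner ℝ (pd k (pd i X) x) (pd j N x) - inner ℝ (pd i X x) (pd k (pd j N) x)) := by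
  have hAd : ∀ i j, DifferentiableAt ℝ (fun y => shape X N y i j) x := fun i j =>
    differentiableAt_of_contDiffOn hX.isOpen (hX.contDiffOn_shape i j) hx
  have hgd : ∀ i j, DifferentiableAt ℝ (fun y => gram X y i j) x := fun i j =>
    differentiableAt_of_contDiffOn hX.isOpen (hX.contDiffOn_gram i j) hx
  have hXd : ∀ i, DifferentiableAt ℝ (pd i X) x := fun i =>
    differentiableAt_of_contDiffOn hX.isOpen (hX.contDiffOn_pd i) hx
  have hNd : ∀ i, DifferentiableAt ℝ (pd i N) x := fun i =>
    differentiableAt_of_contDiffOn hX.isOpen (Hypersurface.contDiffOn_pd hX.isOpen hX.smooth_normal i) hx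
  have h1 : n * pd k (meanCurv X N) x = (matPd k (shape X N) x).trace := by
    have hm := differentiableAt_of_contDiffOn hX.isOpen hX.contDiffOn_meanCurv hx
    have e1 := pd_mul (differentiableAt_const (n : ℝ)) hm k
    rw [pd_const, zero_mul, add_zero] at e1
    rw [← e1]
    simp only [card_mul_meanCurv, Matrix.trace, Matrix.diag_apply]
    rw [pd_sum fun i _ => hAd i i]
    rfl
  have h2 : matPd k (secondForm X N) x =
      matPd k (gram X) x * shape X N x + gram X x * matPd k (shape X N) x := by
    rw [← matPd_mul hgd hAd]
    ext i j
    exact pd_congr_of_isOpen hX.isOpen (fun y hy => by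
      change _ = (gram X y * shape X N y) i j
      rw [hX.gram_mul_shape hy]) hx k
  have h3 : matPd k (shape X N) x = (gram X x)⁻¹ * matPd k (secondForm X N) x -
      (gram X x)⁻¹ * matPd k (gram X) x * shape X N x := by
    rw [h2, mul_add, ← mul_assoc, ← mul_assoc, hX.gram_inv_mul hx, one_mul, add_sub_cancel_left]
  have h4 : ∀ i j, matPd k (secondForm X N) x i j =
      -(inner ℝ (pd i X x) (pd k (pd j N) x) + inner ℝ (pd k (pd i X) x) (pd j N x)) := by
    intro i j
    rw [← pd_inner (hXd i) (hNd j) k, ← pd_neg]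
    exact pd_congr_of_isOpen hX.isOpen (fun y hy => hX.secondForm_eq hy i j) hx k
  rw [h1, h3, Matrix.trace_sub, hX.trace_inv_mul_matPd_gram_mul_shape hx]
  have h5 : ((gram X x)⁻¹ * matPd k (secondForm X N) x).trace = ∑ i, ∑ j, (gram X x)⁻¹ i j *
      -(inner ℝ (pd i X x) (pd k (pd j N) x) + inner ℝ (pd k (pd i X) x) (pd j N x)) := by
    simp only [Matrix.trace, Matrix.diag_apply, Matrix.mul_apply]
    rw [Finset.sum_comm]
    exact Finset.sum_congr rfl fun i _ => Finset.sum_congr rfl fun j _ => by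
      rw [h4, gram_inv_comm]
  rw [h5, Finset.mul_sum, ← Finset.sum_sub_distrib]
  refine Finset.sum_congr rfl fun i _ => ?_
  rw [Finset.mul_sum, ← Finset.sum_sub_distrib]
  exact Finset.sum_congr rfl fun j _ => by ring

/-- The tangential part of `Δ H` is `- 2 A ∇h - n h ∇h`, in the form
`⟨Δ H, ∂ₖ X⟩ = - 2 II(∇h, ∂ₖ) - n h ∂ₖ h`. -/
theorem IsHypersurface.inner_laplacian_meanCurvVec (hX : IsHypersurface Ω X N) (hx : x ∈ Ω)
    (k : Fin n) :
    inner ℝ (laplacian X (meanCurvVec X N) x) (pd k X x) =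
      -2 * ∑ j, grad X (meanCurv X N) x j * secondForm X N x j k -
        n * meanCurv X N x * pd k (meanCurv X N) x := by
  have hXd : ∀ i, DifferentiableAt ℝ (pd i X) x := fun i =>
    differentiableAt_of_contDiffOn hX.isOpen (hX.contDiffOn_pd i) hx
  have hNd : ∀ i, DifferentiableAt ℝ (pd i N) x := fun i =>
    differentiableAt_of_contDiffOn hX.isOpen
      (Hypersurface.contDiffOn_pd hX.isOpen hX.smooth_normal i) hx
  have hhd : ∀ y ∈ Ω, DifferentiableAt ℝ (meanCurv X N) y := fun y hy =>
    differentiableAt_of_contDiffOn hX.isOpen hX.contDiffOn_meanCurv hy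
  have hN : ∀ y ∈ Ω, DifferentiableAt ℝ N y := fun y hy =>
    differentiableAt_of_contDiffOn hX.isOpen hX.smooth_normal hy
  have hhd' : ∀ i, DifferentiableAt ℝ (pd i (meanCurv X N)) x := fun i =>
    differentiableAt_of_contDiffOn hX.isOpen
      (Hypersurface.contDiffOn_pd hX.isOpen hX.contDiffOn_meanCurv i) hx
  have hF : ContDiffOn ℝ ∞ (meanCurvVec X N) Ω := hX.contDiffOn_meanCurv.smul hX.smooth_normal
  set h := meanCurv X N with hh
  set G := (gram X x)⁻¹ with hG
  have hF1 : ∀ i, ∀ y ∈ Ω, pd i (meanCurvVec X N) y = h y • pd i N y + pd i h y • N y :=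
    fun i y hy => pd_smul (hhd y hy) (hN y hy) i
  have hI1 : ∀ i, inner ℝ (pd i (meanCurvVec X N) x) (pd k X x) =
      h x * inner ℝ (pd i X x) (pd k N x) := by
    intro i
    rw [hF1 i x hx, inner_add_left, real_inner_smul_left, real_inner_smul_left,
      real_inner_comm, real_inner_comm (pd k X x) (N x), hX.inner_pd_normal hx, mul_zero, add_zero]
    have := hX.secondForm_comm hx i k
    rw [hX.secondForm_eq hx, hX.secondForm_eq hx] at this
    rw [neg_inj.1 this]
  have hI2 : ∀ i j, inner ℝ (pd j (pd i (meanCurvVec X N)) x) (pd k X x) =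
      h x * inner ℝ (pd j (pd i N) x) (pd k X x) -
        pd j h x * secondForm X N x i k - pd i h x * secondForm X N x j k := by
    intro i j
    have hsi := hX.secondForm_comm hx k i
    have hsj := hX.secondForm_comm hx k j
    rw [hX.secondForm_eq hx] at hsi hsj
    rw [pd_congr_of_isOpen hX.isOpen (hF1 i) hx,
      pd_add ((hhd x hx).fun_smul (hNd i)) ((hhd' i).fun_smul (hN x hx)),
      pd_smul (hhd x hx) (hNd i), pd_smul (hhd' i) (hN x hx)]
    simp only [inner_add_left, real_inner_smul_left]
    rw [real_inner_comm (pd k X x) (N x), hX.inner_pd_normal hx, ← hsi, ← hsj,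
      real_inner_comm (pd k X x) (pd i N x), real_inner_comm (pd k X x) (pd j N x)]
    ring
  -- `⟨∂ₖX, ∂ᵢN⟩ = ⟨∂ᵢX, ∂ₖN⟩`, differentiated
  have hI3 : ∀ i j, inner ℝ (pd j (pd i N) x) (pd k X x) =
      inner ℝ (pd j (pd i X) x) (pd k N x) + inner ℝ (pd i X x) (pd k (pd j N) x) -
        inner ℝ (pd k (pd j X) x) (pd i N x) := by
    intro i j
    have e : pd j (fun y => inner ℝ (pd k X y) (pd i N y)) x =
        pd j (fun y => inner ℝ (pd i X y) (pd k N y)) x := by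
      refine pd_congr_of_isOpen hX.isOpen (fun y hy => ?_) hx j
      have := hX.secondForm_comm hy i k
      rw [hX.secondForm_eq hy, hX.secondForm_eq hy] at this
      exact (neg_inj.1 this).symm
    rw [pd_inner (hXd k) (hNd i), pd_inner (hXd i) (hNd k)] at e
    rw [real_inner_comm, pd_comm hX.isOpen hX.smooth_normal hx k j,
      pd_comm hX.isOpen hX.smooth hx k j]
    linarith
  rw [hX.laplacian_eq hF hx, inner_sub_left]
  simp only [sum_inner, real_inner_smul_left, hI1, hI2]
  -- the Christoffel terms cancel, since `∂ₖN` is tangent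
  have hT : ∑ i, christoffelTrace X x i * (h x * inner ℝ (pd i X x) (pd k N x)) =
      h x * inner ℝ (hessTrace X x) (pd k N x) := by
    have hproj : hessTrace X x - ∑ i, christoffelTrace X x i • pd i X x =
        inner ℝ (hessTrace X x) (N x) • N x := by
      rw [← sub_eq_zero]
      refine hX.eq_zero_of_inner_eq_zero hx (fun a => ?_) ?_
      · rw [inner_sub_left, inner_sub_left, real_inner_smul_left, real_inner_comm,
          real_inner_comm (pd a X x) (N x), hX.inner_pd_normal hx, mul_zero, sub_zero,
          sum_inner, sub_eq_zero]
        set c : Fin n → ℝ := fun b => inner ℝ (hessTrace X x) (pd b X x) with hc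
        have e1 : ∑ i, inner ℝ (christoffelTrace X x i • pd i X x) (pd a X x) =
            (gram X x *ᵥ ((gram X x)⁻¹ *ᵥ c)) a := by
          refine Finset.sum_congr rfl fun i _ => ?_
          rw [real_inner_smul_left, mul_comm, real_inner_comm]
          rfl
        rw [e1, Matrix.mulVec_mulVec, hX.gram_mul_inv hx, Matrix.one_mulVec, hc, real_inner_comm]
      · rw [inner_sub_left, inner_sub_left, real_inner_smul_left, real_inner_self_eq_norm_sq,
          hX.norm_normal x hx, sum_inner, Finset.sum_eq_zero, sub_zero]
        · ring
        · intro i _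
          rw [real_inner_smul_left, hX.inner_pd_normal hx, mul_zero]
    have e2 := congrArg (fun z => inner ℝ z (pd k N x)) hproj
    simp only [inner_sub_left, sum_inner, real_inner_smul_left] at e2
    rw [real_inner_comm (pd k N x) (N x), hX.inner_pd_normal_normal hx, mul_zero,
      sub_eq_zero] at e2
    rw [e2, Finset.mul_sum]
    exact Finset.sum_congr rfl fun i _ => by ring
  rw [hT]
  have hT2 : inner ℝ (hessTrace X x) (pd k N x) =
      ∑ i, ∑ j, G i j * inner ℝ (pd j (pd i X) x) (pd k N x) := by
    simp only [hessTrace, sum_inner, real_inner_smul_left]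
    rfl
  have hgrad : ∀ j, grad X h x j = ∑ i, G i j * pd i h x := by
    intro j
    simp only [grad, Matrix.mulVec, dotProduct]
    exact Finset.sum_congr rfl fun i _ => by
      rw [show G i j = G j i from gram_inv_comm X x i j]
  have hS1 : ∑ i, ∑ j, G i j * (pd i h x * secondForm X N x j k) =
      ∑ j, grad X h x j * secondForm X N x j k := by
    rw [Finset.sum_comm]
    refine Finset.sum_congr rfl fun j _ => ?_
    rw [hgrad, Finset.sum_mul]
    exact Finset.sum_congr rfl fun i _ => by ring
  have hS2 : ∑ i, ∑ j, G i j * (pd j h x * secondForm X N x i k) =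
      ∑ j, grad X h x j * secondForm X N x j k := by
    rw [← hS1, Finset.sum_comm]
    exact Finset.sum_congr rfl fun i _ => Finset.sum_congr rfl fun j _ => by
      rw [show G i j = G j i from gram_inv_comm X x i j]
  have hS3 : n * pd k h x = ∑ i, ∑ j, G i j * (inner ℝ (pd k (pd j X) x) (pd i N x) -
      inner ℝ (pd i X x) (pd k (pd j N) x)) := by
    rw [hX.card_mul_pd_meanCurv hx]
    simp only [mul_sub, Finset.sum_sub_distrib]
    congr 1
    rw [Finset.sum_comm]
    exact Finset.sum_congr rfl fun i _ => Finset.sum_congr rfl fun j _ => by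
      rw [show (gram X x)⁻¹ j i = G i j from gram_inv_comm X x j i]
  rw [mul_right_comm, hS3, hT2, ← hS1]
  have hS4 := hS2.trans hS1.symm
  have hpull : ∀ a : Fin n → Fin n → ℝ,
      ∑ i, ∑ j, G i j * (h x * a i j) = h x * ∑ i, ∑ j, G i j * a i j := by
    intro a
    rw [Finset.mul_sum]
    refine Finset.sum_congr rfl fun i _ => ?_
    rw [Finset.mul_sum]
    exact Finset.sum_congr rfl fun j _ => mul_left_comm _ _ _
  simp only [hI3, mul_sub, mul_add, Finset.sum_sub_distrib, Finset.sum_add_distrib]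
  rw [hS4, hpull, hpull, hpull]
  ring

/-- On a biconservative hypersurface `A ∇h = - (n h / 2) ∇h`. -/
theorem IsHypersurface.shape_mulVec_grad (hX : IsHypersurface Ω X N)
    (hB : IsBiconservative Ω X N) (hx : x ∈ Ω) :
    shape X N x *ᵥ grad X (meanCurv X N) x =
      specialCurv X N x • grad X (meanCurv X N) x := by
  have h1 : secondForm X N x *ᵥ grad X (meanCurv X N) x =
      specialCurv X N x • fun k => pd k (meanCurv X N) x := by
    ext k
    have h2 := hX.inner_laplacian_meanCurvVec hx k
    rw [pd, hB x hx] at h2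
    have h3 : (secondForm X N x *ᵥ grad X (meanCurv X N) x) k =
        ∑ j, grad X (meanCurv X N) x j * secondForm X N x j k := by
      simp only [Matrix.mulVec, dotProduct]
      exact Finset.sum_congr rfl fun j _ => by
        rw [mul_comm, show secondForm X N x k j = secondForm X N x j k from
          hX.secondForm_comm hx k j]
    rw [h3, Pi.smul_apply, smul_eq_mul, specialCurv]
    linarith
  rw [shape, ← Matrix.mulVec_mulVec, h1, Matrix.mulVec_smul]
  rfl

end Hypersurface

namespace Hypersurface

/-! ### Kernels of continuous families of endomorphisms -/

section Kernel

variable {E : Type*} [NormedAddCommGroup E] [NormedSpace ℝ E] [FiniteDimensional ℝ E]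

theorem isUnit_of_injective {M : E →L[ℝ] E} (hM : Function.Injective M) : IsUnit M := by
  have hs : Function.Surjective (M : E →ₗ[ℝ] E) := LinearMap.injective_iff_surjective.1 hM
  rw [ContinuousLinearMap.isUnit_iff_bijective]
  exact ⟨hM, hs⟩

/-- An endomorphism of a finite dimensional space becomes invertible after adding one whose range
has the dimension of the kernel. -/
theorem exists_isUnit_add (M : E →L[ℝ] E) :
    ∃ Q : E →L[ℝ] E, IsUnit (M + Q) ∧
      Module.finrank ℝ (LinearMap.range (Q : E →ₗ[ℝ] E)) =
        Module.finrank ℝ (LinearMap.ker (M : E →ₗ[ℝ] E)) := by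
  set K := LinearMap.ker (M : E →ₗ[ℝ] E)
  set R := LinearMap.range (M : E →ₗ[ℝ] E)
  obtain ⟨K', hK'⟩ := Submodule.exists_isCompl K
  obtain ⟨R', hR'⟩ := Submodule.exists_isCompl R
  have hdim : Module.finrank ℝ K = Module.finrank ℝ R' := by
    have h1 := LinearMap.finrank_range_add_finrank_ker (M : E →ₗ[ℝ] E)
    have h2 := Submodule.finrank_add_eq_of_isCompl hR'
    change Module.finrank ℝ R + Module.finrank ℝ K = _ at h1
    omega
  set e : K ≃ₗ[ℝ] R' := LinearEquiv.ofFinrankEq _ _ hdim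
  set π : E →ₗ[ℝ] K := K.projectionOnto K' hK'
  have hπ : ∀ v : K, π v = v := fun v => Submodule.projectionOnto_apply_left hK' v
  set Q : E →ₗ[ℝ] E := R'.subtype ∘ₗ e.toLinearMap ∘ₗ π
  have hQR : ∀ v, Q v ∈ R' := fun v => (e (π v)).2
  refine ⟨LinearMap.toContinuousLinearMap Q, isUnit_of_injective ?_, ?_⟩
  · rw [injective_iff_map_eq_zero]
    intro v hv
    have hv' : M v + Q v = 0 := hv
    have hQ0 : Q v = 0 := by
      have hmem : Q v ∈ R := by
        rw [eq_neg_of_add_eq_zero_right hv']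
        exact R.neg_mem ⟨v, rfl⟩
      exact Submodule.disjoint_def.1 hR'.disjoint _ hmem (hQR v)
    have hvK : v ∈ K := by
      rw [hQ0, add_zero] at hv'
      exact hv'
    have h3 : e (π v) = 0 := Subtype.ext hQ0
    rw [hπ ⟨v, hvK⟩, LinearEquiv.map_eq_zero_iff] at h3
    exact congrArg Subtype.val h3
  · have : LinearMap.range Q = R' := by
      refine le_antisymm ?_ fun r hr => ?_
      · rintro _ ⟨v, rfl⟩
        exact hQR v
      · refine ⟨(e.symm ⟨r, hr⟩ : K), ?_⟩
        change (e (π (e.symm ⟨r, hr⟩ : K)) : E) = r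
        rw [hπ, LinearEquiv.apply_symm_apply]
    rw [hdim, ← this]
    rfl

/-- Near a point the kernels of a continuous family of endomorphisms lie in the ranges of a
continuous family of endomorphisms that fixes the kernel at the point, and whose ranges are not
larger than that kernel. -/
theorem exists_kernel_le_range {F : Type*} [TopologicalSpace F] {M : F → E →L[ℝ] E} {p : F}
    (hM : ContinuousAt M p) :
    ∃ T : F → E →L[ℝ] E, ContinuousAt T p ∧ (∀ v, M p v = 0 → T p v = v) ∧
      ∀ᶠ y in 𝓝 p, LinearMap.ker (M y : E →ₗ[ℝ] E) ≤ LinearMap.range (T y : E →ₗ[ℝ] E) ∧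
        Module.finrank ℝ (LinearMap.range (T y : E →ₗ[ℝ] E)) ≤
          Module.finrank ℝ (LinearMap.ker (M p : E →ₗ[ℝ] E)) := by
  obtain ⟨Q, hQ, hdim⟩ := exists_isUnit_add (M p)
  have hMQ : ContinuousAt (fun y => M y + Q) p := hM.add continuousAt_const
  have hinv : ContinuousAt (fun y => Ring.inverse (M y + Q)) p := by
    have h := NormedRing.inverse_continuousAt hQ.unit
    rw [hQ.unit_spec] at h
    exact ContinuousAt.comp (f := fun y => M y + Q) h hMQ
  have hunit : ∀ᶠ y in 𝓝 p, IsUnit (M y + Q) := hMQ.eventually (Units.isOpen.mem_nhds hQ)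
  -- a vector of `ker (M y)` is recovered from its image under `Q`
  have hfix : ∀ y v, IsUnit (M y + Q) → M y v = 0 → (Ring.inverse (M y + Q) * Q) v = v := by
    intro y v hu hv
    have h1 : Q v = (M y + Q) v := by simp [hv]
    calc (Ring.inverse (M y + Q) * Q) v = (Ring.inverse (M y + Q) * (M y + Q)) v :=
          congrArg (Ring.inverse (M y + Q) : E →L[ℝ] E) h1
      _ = v := by rw [Ring.inverse_mul_cancel _ hu]; rfl
  refine ⟨fun y => Ring.inverse (M y + Q) * Q, hinv.mul continuousAt_const,
    fun v hv => hfix p v hQ hv, ?_⟩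
  filter_upwards [hunit] with y hy
  refine ⟨fun v hv => ⟨v, hfix y v hy hv⟩, ?_⟩
  rw [← hdim]
  have : LinearMap.range ((Ring.inverse (M y + Q) * Q : E →L[ℝ] E) : E →ₗ[ℝ] E) =
      (LinearMap.range (Q : E →ₗ[ℝ] E)).map
        (Ring.inverse (M y + Q) : E →L[ℝ] E).toLinearMap :=
    LinearMap.range_comp _ _
  rw [this]
  exact Submodule.finrank_map_le _ _

theorem eventually_finrank_ker_le {F : Type*} [TopologicalSpace F] {M : F → E →L[ℝ] E} {p : F}
    (hM : ContinuousAt M p) :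
    ∀ᶠ y in 𝓝 p, Module.finrank ℝ (LinearMap.ker (M y : E →ₗ[ℝ] E)) ≤
      Module.finrank ℝ (LinearMap.ker (M p : E →ₗ[ℝ] E)) := by
  obtain ⟨T, -, -, hT⟩ := exists_kernel_le_range hM
  filter_upwards [hT] with y hy
  exact (Submodule.finrank_mono hy.1).trans hy.2

/-- Where the dimension of the kernel is locally constant, every vector of the kernel at a point
extends to a family of vectors of the kernels that is continuous at the point. -/
theorem exists_kernel_section {F : Type*} [TopologicalSpace F] {M : F → E →L[ℝ] E} {p : F}
    (hM : ContinuousAt M p)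
    (hconst : ∀ᶠ y in 𝓝 p, Module.finrank ℝ (LinearMap.ker (M y : E →ₗ[ℝ] E)) =
      Module.finrank ℝ (LinearMap.ker (M p : E →ₗ[ℝ] E)))
    {v : E} (hv : M p v = 0) :
    ∃ w : F → E, ContinuousAt w p ∧ w p = v ∧ ∀ᶠ y in 𝓝 p, M y (w y) = 0 := by
  obtain ⟨T, hTc, hTp, hT⟩ := exists_kernel_le_range hM
  refine ⟨fun y => T y v, hTc.clm_apply continuousAt_const, hTp v hv, ?_⟩
  filter_upwards [hT, hconst] with y hy hc
  have heq := Submodule.eq_of_le_of_finrank_le hy.1 (hc ▸ hy.2)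
  have : T y v ∈ LinearMap.ker (M y : E →ₗ[ℝ] E) := heq ▸ LinearMap.mem_range_self _ v
  exact this

end Kernel

/-- If a family of linear forms vanishes at `p`, and vanishes at nearby points on vectors
converging to `w`, then its value on `w` vanishes at `p` to first order. -/
theorem hasFDerivAt_zero_of_eventually_apply_eq_zero {E F : Type*} [NormedAddCommGroup E]
    [NormedSpace ℝ E] [NormedAddCommGroup F] [NormedSpace ℝ F] {φ : F → E →L[ℝ] ℝ} {p : F}
    (hφ : DifferentiableAt ℝ φ p) (hφp : φ p = 0)
    {w : F → E} (hw : ContinuousAt w p) (h0 : ∀ᶠ y in 𝓝 p, φ y (w y) = 0) :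
    HasFDerivAt (fun y => φ y (w p)) (0 : F →L[ℝ] ℝ) p := by
  rw [hasFDerivAt_iff_isLittleO]
  have h1 : φ =O[𝓝 p] fun y => y - p := by
    simpa [hφp] using hφ.hasFDerivAt.isBigO_sub
  have h2 : (fun y => w p - w y) =o[𝓝 p] fun _ => (1 : ℝ) := by
    rw [Asymptotics.isLittleO_one_iff]
    have : Filter.Tendsto (fun y => w p - w y) (𝓝 p) (𝓝 (w p - w p)) :=
      Filter.Tendsto.sub tendsto_const_nhds hw
    simpa using this
  have h3 : (fun y => ‖φ y‖ * ‖w p - w y‖) =o[𝓝 p] fun y => ‖y - p‖ * ‖(1 : ℝ)‖ :=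
    h1.norm_norm.mul_isLittleO h2.norm_norm
  have h4 : (fun y => φ y (w p) - φ p (w p) - (0 : F →L[ℝ] ℝ) (y - p)) =O[𝓝 p]
      fun y => ‖φ y‖ * ‖w p - w y‖ := by
    refine Asymptotics.IsBigO.of_bound 1 ?_
    filter_upwards [h0] with y hy
    have : φ y (w p) - φ p (w p) - (0 : F →L[ℝ] ℝ) (y - p) = φ y (w p - w y) := by
      simp [hφp, hy]
    rw [this, one_mul, norm_mul, norm_norm, norm_norm]
    exact (φ y).le_opNorm _
  have h5 := h4.trans_isLittleO h3
  simp only [norm_one, mul_one] at h5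
  exact h5.of_norm_right

/-! ### The eigenspaces for the value `- n h / 2` -/

variable {n : ℕ} {Ω : Set (Coord n)} {X N : Coord n → Euc (n + 1)} {x : Coord n}

/-- The endomorphism `A - λ` of the coordinate space, for `λ = - n h / 2`. -/
noncomputable def shapeSub (X N : Coord n → Euc (n + 1)) (x : Coord n) : Coord n →L[ℝ] Coord n :=
  LinearMap.toContinuousLinearMap (Matrix.toLin' (shape X N x)) -
    specialCurv X N x • ContinuousLinearMap.id ℝ (Coord n)

theorem shapeSub_apply (X N : Coord n → Euc (n + 1)) (x v : Coord n) :
    shapeSub X N x v = shape X N x *ᵥ v - specialCurv X N x • v := by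
  simp [shapeSub]

theorem rankAt_eq (X N : Coord n → Euc (n + 1)) (x : Coord n) :
    rankAt X N x =
      Module.finrank ℝ (LinearMap.ker (shapeSub X N x : Coord n →ₗ[ℝ] Coord n)) := by
  have : Module.End.eigenspace (Matrix.toLin' (shape X N x)) (specialCurv X N x) =
      LinearMap.ker (shapeSub X N x : Coord n →ₗ[ℝ] Coord n) := by
    ext v
    rw [Module.End.mem_eigenspace_iff, LinearMap.mem_ker, ContinuousLinearMap.coe_coe,
      shapeSub_apply, sub_eq_zero, Matrix.toLin'_apply]
  rw [rankAt, this]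

theorem IsHypersurface.contDiffOn_specialCurv (hX : IsHypersurface Ω X N) :
    ContDiffOn ℝ ∞ (specialCurv X N) Ω :=
  ((contDiffOn_const.mul hX.contDiffOn_meanCurv).neg).div_const 2

theorem IsHypersurface.fderiv_specialCurv (hX : IsHypersurface Ω X N) (hx : x ∈ Ω)
    (v : Coord n) :
    fderiv ℝ (specialCurv X N) x v = -(n * fderiv ℝ (meanCurv X N) x v) / 2 := by
  have hd := differentiableAt_of_contDiffOn hX.isOpen hX.contDiffOn_meanCurv hx
  have h1 : HasFDerivAt (specialCurv X N)
      ((-(n : ℝ) / 2) • fderiv ℝ (meanCurv X N) x) x := by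
    have h2 := hd.hasFDerivAt.const_mul (-(n : ℝ) / 2)
    refine h2.congr_of_eventuallyEq (Filter.Eventually.of_forall fun y => ?_)
    simp only [specialCurv]
    ring
  rw [h1.fderiv, smul_apply, smul_eq_mul]
  ring

theorem IsHypersurface.continuousAt_shapeSub (hX : IsHypersurface Ω X N) (hx : x ∈ Ω) :
    ContinuousAt (shapeSub X N) x := by
  have hA : ContinuousAt (shape X N) x :=
    continuousAt_pi.2 fun i => continuousAt_pi.2 fun j =>
      (hX.contDiffOn_shape i j).continuousOn.continuousAt (hX.isOpen.mem_nhds hx)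
  have hl : Continuous fun P : Matrix (Fin n) (Fin n) ℝ =>
      (LinearMap.toContinuousLinearMap (Matrix.toLin' P) : Coord n →L[ℝ] Coord n) :=
    LinearMap.continuous_of_finiteDimensional
      (LinearMap.toContinuousLinearMap.toLinearMap ∘ₗ
        (Matrix.toLin' (R := ℝ) (m := Fin n) (n := Fin n)).toLinearMap)
  exact (hl.continuousAt.comp hA).sub
    ((hX.contDiffOn_specialCurv.continuousOn.continuousAt (hX.isOpen.mem_nhds hx)).smul
      continuousAt_const)

theorem IsHypersurface.eventually_rankAt_le (hX : IsHypersurface Ω X N) (hx : x ∈ Ω) :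
    ∀ᶠ y in 𝓝 x, rankAt X N y ≤ rankAt X N x := by
  simp only [rankAt_eq]
  exact eventually_finrank_ker_le (hX.continuousAt_shapeSub hx)

theorem IsHypersurface.metric_shapeSub (hX : IsHypersurface Ω X N) (hx : x ∈ Ω)
    (v w : Coord n) :
    metric X x v (shapeSub X N x w) = -inner ℝ (fderiv ℝ X x v)
      (fderiv ℝ N x w + specialCurv X N x • fderiv ℝ X x w) := by
  rw [metric, shapeSub_apply, hX.fderiv_normal hx, map_sub, map_smul, ← inner_neg_right]
  congr 1
  abel

theorem IsHypersurface.metric_shapeSub_comm (hX : IsHypersurface Ω X N) (hx : x ∈ Ω)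
    (v w : Coord n) : metric X x v (shapeSub X N x w) = metric X x (shapeSub X N x v) w := by
  have h := hX.metric_shape hx v w
  simp only [metric, shapeSub_apply, map_sub, map_smul, inner_sub_left, inner_sub_right,
    real_inner_smul_left, real_inner_smul_right] at h ⊢
  rw [h]

/-- The Codazzi equation on the eigenspaces for `λ = - n h / 2`: where their dimension is locally
constant, `dλ(u) g(v, w)` is symmetric in `u` and `w`. -/
theorem IsHypersurface.codazzi_of_rankAt_const (hX : IsHypersurface Ω X N) (hx : x ∈ Ω)
    (hconst : ∀ᶠ y in 𝓝 x, rankAt X N y = rankAt X N x) {u v w : Coord n}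
    (hu : shapeSub X N x u = 0) (hv : shapeSub X N x v = 0) (hw : shapeSub X N x w = 0) :
    fderiv ℝ (specialCurv X N) x u * metric X x v w =
      fderiv ℝ (specialCurv X N) x w * metric X x v u := by
  simp only [rankAt_eq] at hconst
  have hXd : DifferentiableAt ℝ (fderiv ℝ X) x :=
    differentiableAt_of_contDiffOn hX.isOpen
      (hX.smooth.fderiv_of_isOpen hX.isOpen (m := ∞) (by simp)) hx
  have hNd : DifferentiableAt ℝ (fderiv ℝ N) x :=
    differentiableAt_of_contDiffOn hX.isOpen
      (hX.smooth_normal.fderiv_of_isOpen hX.isOpen (m := ∞) (by simp)) hx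
  have hl := differentiableAt_of_contDiffOn hX.isOpen hX.contDiffOn_specialCurv hx
  set lam := specialCurv X N
  -- the forms `w ↦ g(v, (A - λ) w)`
  set ψ : Coord n → Coord n →L[ℝ] Euc (n + 1) := fun y => fderiv ℝ N y + lam y • fderiv ℝ X y
  have hψd : HasFDerivAt ψ (fderiv ℝ (fderiv ℝ N) x + (lam x • fderiv ℝ (fderiv ℝ X) x +
      (fderiv ℝ lam x).smulRight (fderiv ℝ X x))) x :=
    hNd.hasFDerivAt.add (hl.hasFDerivAt.smul hXd.hasFDerivAt)
  set φ : Coord n → Coord n →L[ℝ] ℝ := fun y => (innerSL ℝ (fderiv ℝ X y v)).comp (ψ y)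
  have hφ : ∀ y ∈ Ω, ∀ z, metric X y v (shapeSub X N y z) = -φ y z := fun y hy z =>
    hX.metric_shapeSub hy v z
  have hφd : DifferentiableAt ℝ φ x := by
    refine DifferentiableAt.clm_comp ?_ hψd.differentiableAt
    exact ((innerSL ℝ).differentiableAt).comp x (hXd.clm_apply (differentiableAt_const v))
  have hφ0 : φ x = 0 := by
    ext z
    have h1 := hφ x hx z
    rw [hX.metric_shapeSub_comm hx, hv, metric, map_zero, inner_zero_left] at h1
    exact neg_eq_zero.1 h1.symm
  have hψ0 : ∀ z, shapeSub X N x z = 0 → ψ x z = 0 := by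
    intro z hz
    rw [shapeSub_apply, sub_eq_zero] at hz
    change fderiv ℝ N x z + lam x • fderiv ℝ X x z = 0
    rw [hX.fderiv_normal hx, hz, map_smul, neg_add_cancel]
  have key : ∀ z a, shapeSub X N x z = 0 → inner ℝ (fderiv ℝ X x v)
      (fderiv ℝ (fderiv ℝ N) x a z + (lam x • fderiv ℝ (fderiv ℝ X) x a z +
        fderiv ℝ lam x a • fderiv ℝ X x z)) = 0 := by
    intro z a hz
    obtain ⟨w, hwc, hwx, hw0⟩ := exists_kernel_section (hX.continuousAt_shapeSub hx) hconst hz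
    have h0 : ∀ᶠ y in 𝓝 x, φ y (w y) = 0 := by
      filter_upwards [hw0, hX.isOpen.mem_nhds hx] with y hy hyΩ
      rw [← neg_eq_zero, ← hφ y hyΩ, hy, metric, map_zero, inner_zero_right]
    have h1 := hasFDerivAt_zero_of_eventually_apply_eq_zero hφd hφ0 hwc h0
    rw [hwx] at h1
    have hXv : HasFDerivAt (fun y => fderiv ℝ X y v) ((fderiv ℝ (fderiv ℝ X) x).flip v) x := by
      simpa using hXd.hasFDerivAt.clm_apply (hasFDerivAt_const v x)
    have hψz := hψd.clm_apply (hasFDerivAt_const z x)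
    have h2 := congrArg (fun L : Coord n →L[ℝ] ℝ => L a) (h1.unique (hXv.inner ℝ hψz))
    simpa [hψ0 z hz, fderivInnerCLM_apply] using h2.symm
  have k1 := key w u hw
  have k2 := key u w hu
  rw [fderiv_fderiv_comm hX.isOpen hX.smooth_normal hx u w,
    fderiv_fderiv_comm hX.isOpen hX.smooth hx u w] at k1
  simp only [inner_add_right, real_inner_smul_right] at k1 k2
  rw [metric, metric]
  linarith

theorem IsHypersurface.shapeSub_grad (hX : IsHypersurface Ω X N)
    (hB : IsBiconservative Ω X N) (hx : x ∈ Ω) :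
    shapeSub X N x (grad X (meanCurv X N) x) = 0 := by
  rw [shapeSub_apply, hX.shape_mulVec_grad hB hx, sub_self]

/-- At a regular point with locally constant rank the eigenspace for `- n h / 2` is spanned by
`∇h`: an eigenvector `w` orthogonal to `∇h` would give `|∇h|² |w|² = 0` in the Codazzi equation. -/
theorem IsHypersurface.exists_smul_grad_eq (hX : IsHypersurface Ω X N)
    (hB : IsBiconservative Ω X N) (hx : x ∈ regularSet Ω X N)
    (hconst : ∀ᶠ y in 𝓝 x, rankAt X N y = rankAt X N x) {v : Coord n}
    (hv : shapeSub X N x v = 0) : ∃ c : ℝ, c • grad X (meanCurv X N) x = v := by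
  set u := grad X (meanCurv X N) x with hu
  have hu0 : u ≠ 0 := hX.grad_ne_zero hx.1 hx.2
  have hue : shapeSub X N x u = 0 := hX.shapeSub_grad hB hx.1
  obtain ⟨c, huw⟩ := hX.exists_metric_sub_smul_eq_zero hx.1 hu0 v
  refine ⟨c, ?_⟩
  by_contra hne
  set w := v - c • u with hw
  have hw0 : w ≠ 0 := fun h => hne (sub_eq_zero.1 h).symm
  have hwe : shapeSub X N x w = 0 := by rw [hw, map_sub, map_smul, hv, hue, smul_zero, sub_zero]
  have hww := hX.metric_pos hx.1 hw0
  have h1 := hX.codazzi_of_rankAt_const hx.1 hconst hue hwe hwe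
  rw [metric_comm X x w u, huw, mul_zero, hX.fderiv_specialCurv hx.1,
    ← hX.metric_grad hx.1 (meanCurv X N), ← hu] at h1
  have hn : n ≠ 0 := by
    rintro rfl
    exact hu0 (Subsingleton.elim _ _)
  have hn' : (0 : ℝ) < n := by exact_mod_cast Nat.pos_of_ne_zero hn
  have huu := hX.metric_pos hx.1 hu0
  have : 0 < n * metric X x u u * metric X x w w := by positivity
  linarith

theorem IsHypersurface.rankAt_eq_one (hX : IsHypersurface Ω X N)
    (hB : IsBiconservative Ω X N) (hx : x ∈ regularSet Ω X N)
    (hconst : ∀ᶠ y in 𝓝 x, rankAt X N y = rankAt X N x) : rankAt X N x = 1 := by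
  rw [rankAt_eq]
  have hg := hX.shapeSub_grad hB hx.1
  refine (finrank_eq_one_iff_of_nonzero' (⟨_, hg⟩ : LinearMap.ker
    (shapeSub X N x : Coord n →ₗ[ℝ] Coord n)) fun h =>
      hX.grad_ne_zero hx.1 hx.2 (congrArg Subtype.val h)).2 fun v => ?_
  obtain ⟨c, hc⟩ := hX.exists_smul_grad_eq hB hx hconst v.2
  exact ⟨c, Subtype.ext hc⟩

end Hypersurface

namespace Hypersurface

/-! ### Flatness of the normal bundle of the leaves -/

theorem mem_normalSpace_iff {m k : ℕ} {Y : Coord m → Euc k} {u : Coord m} {z : Euc k} :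
    z ∈ normalSpace Y u ↔ ∀ a, inner ℝ (fderiv ℝ Y u a) z = 0 := by
  rw [normalSpace, Submodule.mem_orthogonal]
  exact ⟨fun h a => h _ ⟨a, rfl⟩, by rintro h _ ⟨a, rfl⟩; exact h a⟩

section ParallelFrame

variable {m k : ℕ} {U : Set (Coord m)} {Y ν η : Coord m → Euc k}

/-- The projection onto the normal space in terms of an orthonormal frame of it. -/
theorem starProjection_normalSpace_eq {u : Coord m} {ν η : Euc k}
    (hν1 : inner ℝ ν ν = (1 : ℝ)) (hη1 : inner ℝ η η = (1 : ℝ)) (hνη : inner ℝ ν η = (0 : ℝ))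
    (hν : ν ∈ normalSpace Y u) (hη : η ∈ normalSpace Y u)
    (hspan : ∀ z ∈ normalSpace Y u, z = (inner ℝ z ν : ℝ) • ν + (inner ℝ z η : ℝ) • η)
    (z : Euc k) :
    (normalSpace Y u).starProjection z = (inner ℝ z ν : ℝ) • ν + (inner ℝ z η : ℝ) • η := by
  refine Submodule.eq_starProjection_of_mem_of_inner_eq_zero
    (Submodule.add_mem _ (Submodule.smul_mem _ _ hν) (Submodule.smul_mem _ _ hη)) fun w hw => ?_
  rw [hspan w hw]
  generalize (inner ℝ w ν : ℝ) = a
  generalize (inner ℝ w η : ℝ) = b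
  have hην : inner ℝ η ν = (0 : ℝ) := by rw [real_inner_comm, hνη]
  simp only [inner_sub_left, inner_add_left, inner_add_right, real_inner_smul_left,
    real_inner_smul_right, hν1, hη1, hνη, hην]
  ring

/-- In terms of a parallel orthonormal frame the normal connection differentiates the
coefficients. -/
theorem normalDeriv_eq_of_parallel_frame (hU : IsOpen U)
    (hνs : ContDiffOn ℝ ∞ ν U) (hηs : ContDiffOn ℝ ∞ η U)
    (hν1 : ∀ u ∈ U, inner ℝ (ν u) (ν u) = (1 : ℝ))
    (hη1 : ∀ u ∈ U, inner ℝ (η u) (η u) = (1 : ℝ))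
    (hνη : ∀ u ∈ U, inner ℝ (ν u) (η u) = (0 : ℝ))
    (hν : ∀ u ∈ U, ν u ∈ normalSpace Y u) (hη : ∀ u ∈ U, η u ∈ normalSpace Y u)
    (hspan : ∀ u ∈ U, ∀ z ∈ normalSpace Y u,
      z = (inner ℝ z (ν u) : ℝ) • ν u + (inner ℝ z (η u) : ℝ) • η u)
    (hpar : ∀ u ∈ U, ∀ a, inner ℝ (fderiv ℝ ν u a) (η u) = (0 : ℝ))
    {ξ : Coord m → Euc k} (hξs : ContDiffOn ℝ ∞ ξ U) (hξ : ∀ u ∈ U, ξ u ∈ normalSpace Y u)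
    (w : Coord m) {u : Coord m} (hu : u ∈ U) :
    normalDeriv Y w ξ u = (fderiv ℝ (fun y => (inner ℝ (ξ y) (ν y) : ℝ)) u w) • ν u +
      (fderiv ℝ (fun y => (inner ℝ (ξ y) (η y) : ℝ)) u w) • η u := by
  have hνd := differentiableAt_of_contDiffOn hU hνs hu
  have hηd := differentiableAt_of_contDiffOn hU hηs hu
  have hξd := differentiableAt_of_contDiffOn hU hξs hu
  have hconst : ∀ {f g : Coord m → Euc k} {c : ℝ}, DifferentiableAt ℝ f u →
      DifferentiableAt ℝ g u → (∀ y ∈ U, inner ℝ (f y) (g y) = c) →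
      inner ℝ (f u) (fderiv ℝ g u w) + inner ℝ (fderiv ℝ f u w) (g u) = 0 := by
    intro f g c hf hg h
    have he : (fun y => inner ℝ (f y) (g y)) =ᶠ[𝓝 u] fun _ => c :=
      Filter.eventually_of_mem (hU.mem_nhds hu) h
    rw [← fderiv_inner_apply ℝ hf hg w, he.fderiv_eq]
    simp
  have hνν : inner ℝ (ν u) (fderiv ℝ ν u w) = (0 : ℝ) := by
    have := hconst hνd hνd hν1
    rw [real_inner_comm (ν u) (fderiv ℝ ν u w)] at this
    linarith
  have hηη : inner ℝ (η u) (fderiv ℝ η u w) = (0 : ℝ) := by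
    have := hconst hηd hηd hη1
    rw [real_inner_comm (η u) (fderiv ℝ η u w)] at this
    linarith
  have hην : inner ℝ (η u) (fderiv ℝ ν u w) = (0 : ℝ) := by
    rw [real_inner_comm]
    exact hpar u hu w
  have hνη' : inner ℝ (ν u) (fderiv ℝ η u w) = (0 : ℝ) := by
    have := hconst hνd hηd hνη
    rw [hpar u hu w] at this
    linarith
  rw [normalDeriv, starProjection_normalSpace_eq (hν1 u hu) (hη1 u hu) (hνη u hu) (hν u hu)
    (hη u hu) (hspan u hu), fderiv_inner_apply ℝ hξd hνd, fderiv_inner_apply ℝ hξd hηd]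
  have e1 : inner ℝ (ξ u) (fderiv ℝ ν u w) = (0 : ℝ) := by
    rw [hspan u hu _ (hξ u hu), inner_add_left, real_inner_smul_left, real_inner_smul_left, hνν,
      hην, mul_zero, mul_zero, add_zero]
  have e2 : inner ℝ (ξ u) (fderiv ℝ η u w) = (0 : ℝ) := by
    rw [hspan u hu _ (hξ u hu), inner_add_left, real_inner_smul_left, real_inner_smul_left, hνη',
      hηη, mul_zero, mul_zero, add_zero]
  rw [e1, e2, zero_add, zero_add]

/-- A submanifold of codimension two whose normal bundle has a parallel orthonormal frame has flat
normal bundle. -/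
theorem hasFlatNormalBundle_of_parallel_frame (hU : IsOpen U)
    (hνs : ContDiffOn ℝ ∞ ν U) (hηs : ContDiffOn ℝ ∞ η U)
    (hν1 : ∀ u ∈ U, inner ℝ (ν u) (ν u) = (1 : ℝ))
    (hη1 : ∀ u ∈ U, inner ℝ (η u) (η u) = (1 : ℝ))
    (hνη : ∀ u ∈ U, inner ℝ (ν u) (η u) = (0 : ℝ))
    (hν : ∀ u ∈ U, ν u ∈ normalSpace Y u) (hη : ∀ u ∈ U, η u ∈ normalSpace Y u)
    (hspan : ∀ u ∈ U, ∀ z ∈ normalSpace Y u,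
      z = (inner ℝ z (ν u) : ℝ) • ν u + (inner ℝ z (η u) : ℝ) • η u)
    (hpar : ∀ u ∈ U, ∀ a, inner ℝ (fderiv ℝ ν u a) (η u) = (0 : ℝ)) :
    HasFlatNormalBundle U Y := by
  intro ξ hξs hξ v w u hu
  have hstep := fun {ζ : Coord m → Euc k} (hζs : ContDiffOn ℝ ∞ ζ U)
    (hζ : ∀ u ∈ U, ζ u ∈ normalSpace Y u) (w : Coord m) {u : Coord m} (hu : u ∈ U) =>
    normalDeriv_eq_of_parallel_frame hU hνs hηs hν1 hη1 hνη hν hη hspan hpar hζs hζ w hu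
  set a : Coord m → ℝ := fun y => inner ℝ (ξ y) (ν y) with ha
  set b : Coord m → ℝ := fun y => inner ℝ (ξ y) (η y) with hb
  have has : ContDiffOn ℝ ∞ a U := hξs.inner ℝ hνs
  have hbs : ContDiffOn ℝ ∞ b U := hξs.inner ℝ hηs
  have has' : ContDiffOn ℝ ∞ (fderiv ℝ a) U := has.fderiv_of_isOpen hU (m := ∞) (by simp)
  have hbs' : ContDiffOn ℝ ∞ (fderiv ℝ b) U := hbs.fderiv_of_isOpen hU (m := ∞) (by simp)
  have key : ∀ v w : Coord m, normalDeriv Y v (normalDeriv Y w ξ) u =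
      fderiv ℝ (fderiv ℝ a) u v w • ν u + fderiv ℝ (fderiv ℝ b) u v w • η u := by
    intro v w
    have h1 : ∀ y ∈ U, normalDeriv Y w ξ y = fderiv ℝ a y w • ν y + fderiv ℝ b y w • η y :=
      fun y hy => hstep hξs hξ w hy
    have h2 : ContDiffOn ℝ ∞ (normalDeriv Y w ξ) U :=
      (((has'.clm_apply contDiffOn_const).smul hνs).add
        ((hbs'.clm_apply contDiffOn_const).smul hηs)).congr h1
    have hηνi : ∀ y ∈ U, inner ℝ (η y) (ν y) = (0 : ℝ) := fun y hy => by
      rw [real_inner_comm, hνη y hy]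
    have h3 : ∀ y ∈ U, inner ℝ (normalDeriv Y w ξ y) (ν y) = fderiv ℝ a y w := by
      intro y hy
      rw [h1 y hy, inner_add_left, real_inner_smul_left, real_inner_smul_left, hν1 y hy,
        hηνi y hy]
      ring
    have h4 : ∀ y ∈ U, inner ℝ (normalDeriv Y w ξ y) (η y) = fderiv ℝ b y w := by
      intro y hy
      rw [h1 y hy, inner_add_left, real_inner_smul_left, real_inner_smul_left, hη1 y hy,
        hνη y hy]
      ring
    have e3 : (fun y => inner ℝ (normalDeriv Y w ξ y) (ν y)) =ᶠ[𝓝 u] fun y => fderiv ℝ a y w :=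
      Filter.eventually_of_mem (hU.mem_nhds hu) h3
    have e4 : (fun y => inner ℝ (normalDeriv Y w ξ y) (η y)) =ᶠ[𝓝 u] fun y => fderiv ℝ b y w :=
      Filter.eventually_of_mem (hU.mem_nhds hu) h4
    have happly : ∀ {f : Coord m → ℝ}, ContDiffOn ℝ ∞ (fderiv ℝ f) U →
        fderiv ℝ (fun y => fderiv ℝ f y w) u v = fderiv ℝ (fderiv ℝ f) u v w := by
      intro f hf
      rw [fderiv_clm_apply (differentiableAt_of_contDiffOn hU hf hu) (differentiableAt_const w)]
      simp
    rw [hstep h2 (fun y _ => Submodule.starProjection_apply_mem _ _) v hu,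
      e3.fderiv_eq, e4.fderiv_eq, happly has', happly hbs']
  rw [key, key, fderiv_fderiv_comm hU has hu, fderiv_fderiv_comm hU hbs hu]

end ParallelFrame

variable {n : ℕ} {Ω : Set (Coord n)} {X N : Coord n → Euc (n + 1)}

/-- The normal bundle of a level set of `h` is spanned by `N` and `dX(∇h)`. These are parallel up to
scaling, since `⟨dN(v), dX(∇h)⟩ = - g(v, A ∇h)` is a multiple of `g(v, ∇h) = dh(v)`, which vanishes
on vectors `v` tangent to the level set. -/
theorem IsHypersurface.hasFlatNormalBundle_of_levelSet (hX : IsHypersurface Ω X N)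
    (hB : IsBiconservative Ω X N) {m : ℕ} {U : Set (Coord m)} (hU : IsOpen U)
    {ψ : Coord m → Coord n} (hψ : ContDiffOn ℝ ∞ ψ U) (hψr : ∀ u ∈ U, ψ u ∈ regularSet Ω X N)
    (htan : ∀ u ∈ U, ∀ a, fderiv ℝ (meanCurv X N) (ψ u) (fderiv ℝ ψ u a) = 0)
    (hsurj : ∀ u ∈ U, ∀ v, fderiv ℝ (meanCurv X N) (ψ u) v = 0 → ∃ a, fderiv ℝ ψ u a = v) :
    HasFlatNormalBundle U (fun u => X (ψ u)) := by
  have hmaps : MapsTo ψ U Ω := fun u hu => (hψr u hu).1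
  have hψd : ∀ u ∈ U, DifferentiableAt ℝ ψ u := fun u hu => differentiableAt_of_contDiffOn hU hψ hu
  have hXd : ∀ x ∈ Ω, DifferentiableAt ℝ X x := fun x hx =>
    differentiableAt_of_contDiffOn hX.isOpen hX.smooth hx
  have hNd : ∀ x ∈ Ω, DifferentiableAt ℝ N x := fun x hx =>
    differentiableAt_of_contDiffOn hX.isOpen hX.smooth_normal hx
  have hdY : ∀ u ∈ U, ∀ a, fderiv ℝ (fun u => X (ψ u)) u a =
      fderiv ℝ X (ψ u) (fderiv ℝ ψ u a) := by
    intro u hu a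
    rw [show (fun u => X (ψ u)) = X ∘ ψ from rfl,
      fderiv_comp u (hXd _ (hmaps hu)) (hψd u hu)]
    rfl
  set gr : Coord n → Coord n := grad X (meanCurv X N) with hgr
  set E : Coord n → Euc (n + 1) := fun x => fderiv ℝ X x (gr x) with hE
  have hgrs : ContDiffOn ℝ ∞ gr Ω := by
    rw [contDiffOn_pi]
    intro i
    simp only [hgr, grad, Matrix.mulVec, dotProduct]
    exact ContDiffOn.sum fun j _ => (hX.contDiffOn_gram_inv i j).mul
      (Hypersurface.contDiffOn_pd hX.isOpen hX.contDiffOn_meanCurv j)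
  have hEs : ContDiffOn ℝ ∞ E Ω :=
    (hX.smooth.fderiv_of_isOpen hX.isOpen (m := ∞) (by simp)).clm_apply hgrs
  have hE0 : ∀ u ∈ U, E (ψ u) ≠ 0 := by
    intro u hu h
    have h1 := hX.metric_pos (hψr u hu).1 (hX.grad_ne_zero (hψr u hu).1 (hψr u hu).2)
    have h2 : E (ψ u) = fderiv ℝ X (ψ u) (grad X (meanCurv X N) (ψ u)) := rfl
    rw [metric, ← h2, h, inner_zero_left] at h1
    exact lt_irrefl _ h1
  set ν : Coord m → Euc (n + 1) := fun u => N (ψ u) with hν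
  set η : Coord m → Euc (n + 1) := fun u => ‖E (ψ u)‖⁻¹ • E (ψ u) with hη
  have hEψ : ContDiffOn ℝ ∞ (fun u => E (ψ u)) U := hEs.comp hψ hmaps
  have hνs : ContDiffOn ℝ ∞ ν U := hX.smooth_normal.comp hψ hmaps
  have hηs : ContDiffOn ℝ ∞ η U :=
    ((hEψ.norm ℝ hE0).inv fun u hu => norm_ne_zero_iff.2 (hE0 u hu)).smul hEψ
  have hEinner : ∀ u ∈ U, ∀ v, inner ℝ (fderiv ℝ X (ψ u) v) (E (ψ u)) =
      fderiv ℝ (meanCurv X N) (ψ u) v := by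
    intro u hu v
    rw [← hX.metric_grad (hmaps hu), real_inner_comm]
    rfl
  have hν1 : ∀ u ∈ U, inner ℝ (ν u) (ν u) = (1 : ℝ) := by
    intro u hu
    rw [real_inner_self_eq_norm_sq, hX.norm_normal _ (hmaps hu), one_pow]
  have hη1 : ∀ u ∈ U, inner ℝ (η u) (η u) = (1 : ℝ) := by
    intro u hu
    rw [real_inner_self_eq_norm_sq, norm_smul, norm_inv, norm_norm,
      inv_mul_cancel₀ (norm_ne_zero_iff.2 (hE0 u hu)), one_pow]
  have hνη : ∀ u ∈ U, inner ℝ (ν u) (η u) = (0 : ℝ) := by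
    intro u hu
    rw [real_inner_smul_right, hX.normal_orthogonal _ (hmaps hu), mul_zero]
  refine hasFlatNormalBundle_of_parallel_frame hU hνs hηs hν1 hη1 hνη ?_ ?_ ?_ ?_
  · intro u hu
    rw [mem_normalSpace_iff]
    intro a
    rw [hdY u hu, real_inner_comm]
    exact hX.normal_orthogonal _ (hmaps hu) _
  · intro u hu
    rw [mem_normalSpace_iff]
    intro a
    rw [hdY u hu, real_inner_smul_right, hEinner u hu, htan u hu, mul_zero]
  · intro u hu z hz
    rw [mem_normalSpace_iff] at hz
    rw [← sub_eq_zero]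
    have hην : inner ℝ (η u) (ν u) = (0 : ℝ) := by rw [real_inner_comm, hνη u hu]
    set d := z - ((inner ℝ z (ν u) : ℝ) • ν u + (inner ℝ z (η u) : ℝ) • η u) with hd
    have hdν : inner ℝ d (ν u) = (0 : ℝ) := by
      rw [hd, inner_sub_left, inner_add_left, real_inner_smul_left, real_inner_smul_left,
        hν1 u hu, hην]
      ring
    have hdη : inner ℝ d (η u) = (0 : ℝ) := by
      rw [hd, inner_sub_left, inner_add_left, real_inner_smul_left, real_inner_smul_left,
        hη1 u hu, hνη u hu]
      ring
    have hdE : inner ℝ d (E (ψ u)) = (0 : ℝ) := by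
      rw [real_inner_smul_right] at hdη
      exact (mul_eq_zero.1 hdη).resolve_left (inv_ne_zero (norm_ne_zero_iff.2 (hE0 u hu)))
    have hdtan : ∀ v, fderiv ℝ (meanCurv X N) (ψ u) v = 0 →
        inner ℝ d (fderiv ℝ X (ψ u) v) = 0 := by
      intro v hv
      obtain ⟨a, rfl⟩ := hsurj u hu v hv
      have h1 := hz a
      rw [hdY u hu, real_inner_comm] at h1
      rw [hd, inner_sub_left, inner_add_left, real_inner_smul_left, real_inner_smul_left, h1,
        hX.normal_orthogonal _ (hmaps hu), real_inner_smul_left,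
        real_inner_comm (fderiv ℝ X (ψ u) (fderiv ℝ ψ u a)) (E (ψ u)), hEinner u hu, hv]
      ring
    refine hX.eq_zero_of_inner_eq_zero (hmaps hu) (fun k => ?_) hdν
    -- split `∂ₖ` into a multiple of the gradient and a vector tangent to the leaf
    set e : Coord n := Pi.single k 1
    have hgg : fderiv ℝ (meanCurv X N) (ψ u) (gr (ψ u)) ≠ 0 := by
      rw [← hEinner u hu]
      exact inner_self_ne_zero.2 (hE0 u hu)
    set c := fderiv ℝ (meanCurv X N) (ψ u) e / fderiv ℝ (meanCurv X N) (ψ u) (gr (ψ u)) with hc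
    have h1 := hdtan (e - c • gr (ψ u)) (by
      rw [map_sub, map_smul, smul_eq_mul, hc, div_mul_cancel₀ _ hgg, sub_self])
    rw [map_sub, map_smul, inner_sub_right, real_inner_smul_right] at h1
    have h2 : inner ℝ d (fderiv ℝ X (ψ u) (gr (ψ u))) = 0 := hdE
    rw [h2, mul_zero, sub_zero] at h1
    exact h1
  · intro u hu a
    have h1 : fderiv ℝ ν u a = fderiv ℝ N (ψ u) (fderiv ℝ ψ u a) := by
      rw [show ν = N ∘ ψ from rfl, fderiv_comp u (hNd _ (hmaps hu)) (hψd u hu)]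
      rfl
    have h2 := hX.metric_shape (hmaps hu) (fderiv ℝ ψ u a) (gr (ψ u))
    rw [hX.shape_mulVec_grad hB (hmaps hu), metric, metric, map_smul,
      real_inner_smul_right] at h2
    have h3 : inner ℝ (fderiv ℝ X (ψ u) (fderiv ℝ ψ u a)) (E (ψ u)) = 0 := by
      rw [hEinner u hu, htan u hu]
    rw [h1, hX.fderiv_normal (hmaps hu), inner_neg_left, real_inner_smul_right]
    have h4 : inner ℝ (fderiv ℝ X (ψ u) (shape X N (ψ u) *ᵥ fderiv ℝ ψ u a)) (E (ψ u)) = 0 := by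
      refine h2.trans ?_
      change _ * inner ℝ _ (E (ψ u)) = 0
      rw [h3, mul_zero]
    rw [h4, mul_zero, neg_zero]

end Hypersurface

namespace Hypersurface

/-! ### Charts adapted to the level sets -/

/-- A map with injective derivative at a point restricts to an embedding of a neighbourhood: it
becomes a local homeomorphism after composition with a left inverse of the derivative. -/
theorem exists_isEmbedding_of_injective_fderiv {E F : Type*} [NormedAddCommGroup E]
    [NormedSpace ℝ E] [FiniteDimensional ℝ E] [NormedAddCommGroup F] [NormedSpace ℝ F]
    [FiniteDimensional ℝ F] {Ω : Set E} (hΩ : IsOpen Ω) {f : E → F} (hf : ContDiffOn ℝ ∞ f Ω)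
    {p : E} (hp : p ∈ Ω) (hinj : Function.Injective (fderiv ℝ f p)) :
    ∃ O : Set E, IsOpen O ∧ p ∈ O ∧ O ⊆ Ω ∧ IsEmbedding (O.domRestrict f) := by
  obtain ⟨L, hL⟩ := LinearMap.exists_leftInverse_of_injective
    (fderiv ℝ f p : E →ₗ[ℝ] F) (LinearMap.ker_eq_bot.2 hinj)
  set L' : F →L[ℝ] E := LinearMap.toContinuousLinearMap L
  have hfp : ContDiffAt ℝ ∞ f p := hf.contDiffAt (hΩ.mem_nhds hp)
  have hg : ContDiffAt ℝ ∞ (fun x => L' (f x)) p := L'.contDiff.contDiffAt.comp p hfp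
  have hg' : HasFDerivAt (fun x => L' (f x))
      (ContinuousLinearEquiv.refl ℝ E : E →L[ℝ] E) p := by
    have h1 := L'.hasFDerivAt.comp p (hfp.differentiableAt (by simp)).hasFDerivAt
    have h2 : (ContinuousLinearEquiv.refl ℝ E : E →L[ℝ] E) = L'.comp (fderiv ℝ f p) :=
      ContinuousLinearMap.ext fun v => (LinearMap.congr_fun hL v).symm
    rw [h2]
    exact h1
  set e := hg.toOpenPartialHomeomorph _ hg' (by simp)
  have hO : e.source ∩ Ω ⊆ e.source := inter_subset_left
  refine ⟨e.source ∩ Ω, e.open_source.inter hΩ,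
    ⟨hg.mem_toOpenPartialHomeomorph_source hg' (by simp), hp⟩, inter_subset_right, ?_⟩
  have h2 : IsEmbedding (L' ∘ (e.source ∩ Ω).domRestrict f) :=
    e.isOpenEmbedding_restrict.isEmbedding.comp (IsEmbedding.inclusion hO)
  refine IsEmbedding.of_comp ?_ L'.continuous h2
  exact (hf.continuousOn.mono inter_subset_right).domRestrict

/-- Replacing a coordinate `xᵢ` with `∂ᵢ h ≠ 0` by the function `h` gives coordinates near `p`,
defined on a set contained in a given neighbourhood and with values in a product of balls. -/
theorem exists_levelSet_chart {m : ℕ} {Ω : Set (Coord (m + 1))} (hΩ : IsOpen Ω)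
    {h : Coord (m + 1) → ℝ} (hh : ContDiffOn ℝ ∞ h Ω) {p : Coord (m + 1)} (hp : p ∈ Ω)
    (hdh : fderiv ℝ h p ≠ 0) :
    ∃ (i : Fin (m + 1)) (φ : OpenPartialHomeomorph (Coord (m + 1)) (Coord m × ℝ)) (r : ℝ),
      0 < r ∧ p ∈ φ.source ∧ φ.source ⊆ Ω ∧
      φ.target = Metric.ball (φ p).1 r ×ˢ Metric.ball (φ p).2 r ∧
      (∀ x, φ x = (fun j => x (i.succAbove j), h x)) ∧
      (∀ x ∈ φ.source, fderiv ℝ h x (Pi.single i 1) ≠ 0) ∧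
      ContDiffOn ℝ ∞ φ φ.source ∧ ContDiffOn ℝ ∞ φ.symm φ.target := by
  obtain ⟨i, hi⟩ : ∃ i, pd i h p ≠ 0 := by
    by_contra! hne
    apply hdh
    ext v
    rw [fderiv_apply_eq_sum_pd]
    simp [hne]
  set π : Coord (m + 1) →L[ℝ] Coord m :=
    ContinuousLinearMap.pi fun j => ContinuousLinearMap.proj (i.succAbove j)
  set F : Coord (m + 1) → Coord m × ℝ := fun x => (π x, h x)
  set O : Set (Coord (m + 1)) := Ω ∩ (pd i h) ⁻¹' {0}ᶜ
  have hO : IsOpen O :=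
    (contDiffOn_pd hΩ hh i).continuousOn.isOpen_inter_preimage hΩ isOpen_compl_singleton
  have hF : ContDiffOn ℝ ∞ F Ω := π.contDiff.contDiffOn.prodMk hh
  have hF' : ∀ x ∈ O, ∃ f' : Coord (m + 1) ≃L[ℝ] Coord m × ℝ,
      HasFDerivAt F (f' : Coord (m + 1) →L[ℝ] Coord m × ℝ) x := by
    intro x hx
    set D : Coord (m + 1) →L[ℝ] Coord m × ℝ := π.prod (fderiv ℝ h x)
    have hinj : Function.Injective (D : Coord (m + 1) →ₗ[ℝ] Coord m × ℝ) := by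
      rw [injective_iff_map_eq_zero]
      intro v hv
      have hv1 : π v = 0 := congrArg Prod.fst hv
      have hv2 : fderiv ℝ h x v = 0 := congrArg Prod.snd hv
      have hv3 : ∀ j, j ≠ i → v j = 0 := by
        intro j hj
        obtain ⟨k, rfl⟩ := Fin.exists_succAbove_eq hj
        exact congrFun hv1 k
      rw [fderiv_apply_eq_sum_pd, Finset.sum_eq_single i (fun j _ hj => by rw [hv3 j hj, zero_smul])
        (fun hi => absurd (Finset.mem_univ _) hi), smul_eq_mul] at hv2
      ext j
      by_cases hj : j = i
      · subst hj
        exact (mul_eq_zero.1 hv2).resolve_right hx.2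
      · exact hv3 j hj
    refine ⟨(LinearEquiv.ofInjectiveOfFinrankEq (D : Coord (m + 1) →ₗ[ℝ] Coord m × ℝ) hinj
      (by simp)).toContinuousLinearEquiv, ?_⟩
    have h1 : HasFDerivAt F D x :=
      π.hasFDerivAt.prodMk (differentiableAt_of_contDiffOn hΩ hh hx.1).hasFDerivAt
    convert h1 using 1
    exact ContinuousLinearMap.ext fun v =>
      LinearMap.congr_fun (LinearEquiv.coe_ofInjectiveOfFinrankEq _ hinj (by simp)) v
  have hpO : p ∈ O := ⟨hp, hi⟩
  obtain ⟨f', hf'⟩ := hF' p hpO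
  have hFp : ContDiffAt ℝ ∞ F p := hF.contDiffAt (hΩ.mem_nhds hp)
  set e := (hFp.toOpenPartialHomeomorph _ hf' (by simp)).restrOpen O hO
  have hpe : p ∈ e.source := ⟨hFp.mem_toOpenPartialHomeomorph_source hf' (by simp), hpO⟩
  have heF : ∀ x, e x = F x := fun x => rfl
  obtain ⟨r, hr, hball⟩ := Metric.isOpen_iff.1 e.open_target (e p) (e.map_source hpe)
  set φ := (e.symm.restrOpen (Metric.ball (e p) r) Metric.isOpen_ball).symm
  have hφt : φ.target = Metric.ball (e p) r := inter_eq_right.2 hball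
  have hφe : ∀ x, φ x = F x := fun x => rfl
  have hφs : φ.source ⊆ O := by
    intro x hx
    have h1 : φ.symm (φ x) ∈ e.source := e.map_target (hball (hφt ▸ φ.map_source hx))
    rw [φ.left_inv hx] at h1
    exact h1.2
  refine ⟨i, φ, r, hr, ?_, fun x hx => (hφs hx).1, ?_, fun x => rfl, fun x hx => (hφs hx).2,
    hF.mono fun x hx => (hφs hx).1, ?_⟩
  · have h1 : φ.symm (e p) ∈ φ.source := φ.map_target (by
      rw [hφt]
      exact Metric.mem_ball_self hr)
    have h2 : φ.symm (e p) = p := e.left_inv hpe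
    rwa [h2] at h1
  · rw [hφt, ball_prod_same]
    rfl
  · intro y hy
    have hy' := φ.map_target hy
    obtain ⟨g', hg'⟩ := hF' _ (hφs hy')
    exact (φ.contDiffAt_symm hy hg'
      (hF.contDiffAt (hΩ.mem_nhds (hφs hy').1))).contDiffWithinAt

end Hypersurface

namespace Hypersurface

/-! ### The foliation by level sets -/

variable {n : ℕ} {Ω : Set (Coord n)} {X N : Coord n → Euc (n + 1)}

theorem IsHypersurface.isOpen_regularSet (hX : IsHypersurface Ω X N) :
    IsOpen (regularSet Ω X N) :=
  (hX.contDiffOn_meanCurv.fderiv_of_isOpen hX.isOpen (m := ∞)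
    (by simp)).continuousOn.isOpen_inter_preimage hX.isOpen
      (isOpen_compl_singleton (x := (0 : Coord n →L[ℝ] ℝ)))

/-- In a chart that replaces one coordinate by `h` each leaf is a graph over the other coordinates,
parametrized by a section `ψ` of the projection `π` that forgets the replaced coordinate. -/
theorem IsHypersurface.isFoliatedByLevelSetsAt (hX : IsHypersurface Ω X N)
    (hB : IsBiconservative Ω X N) {p : Coord n} (hp : p ∈ regularSet Ω X N) :
    IsFoliatedByLevelSetsAt Ω X N p := by
  obtain ⟨m, rfl⟩ : ∃ m, n = m + 1 := by
    rcases n with _ | m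
    · exact absurd (Subsingleton.elim _ _) hp.2
    · exact ⟨m, rfl⟩
  obtain ⟨O, hO, hpO, hOΩ, hemb⟩ := exists_isEmbedding_of_injective_fderiv
    hX.isOpen_regularSet (hX.smooth.mono fun x hx => hx.1) hp (hX.immersion p hp.1)
  obtain ⟨i, φ, r, hr, hpφ, hφO, hφt, hφ, hφi, hφs, hφs'⟩ := exists_levelSet_chart hO
    (hX.contDiffOn_meanCurv.mono fun x hx => (hOΩ hx).1) hpO hp.2
  set U := Metric.ball (φ p).1 r
  set I := Metric.ball (φ p).2 r
  have hU : IsOpen U := Metric.isOpen_ball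
  refine ⟨m, rfl, φ, U, I, hpφ, fun x hx => (hOΩ (hφO hx)).1, hφt, hU,
    Metric.isConnected_ball hr, Metric.isOpen_ball, Metric.isConnected_ball hr, hφs, hφs',
    fun x _ => by rw [hφ], fun t ht => ?_⟩
  set ψ : Coord m → Coord (m + 1) := fun u => φ.symm (u, t) with hψ
  have hmem : ∀ u ∈ U, (u, t) ∈ φ.target := fun u hu => by
    rw [hφt]
    exact ⟨hu, ht⟩
  have hψsrc : ∀ u ∈ U, ψ u ∈ φ.source := fun u hu => φ.map_target (hmem u hu)
  have hψr : ∀ u ∈ U, ψ u ∈ regularSet Ω X N := fun u hu => hOΩ (hφO (hψsrc u hu))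
  have hψs : ContDiffOn ℝ ∞ ψ U :=
    hφs'.comp (contDiff_id.prodMk contDiff_const).contDiffOn hmem
  have hψd : ∀ u ∈ U, DifferentiableAt ℝ ψ u := fun u hu =>
    differentiableAt_of_contDiffOn hU hψs hu
  have hinv : ∀ u ∈ U, ((fun j => ψ u (i.succAbove j)), meanCurv X N (ψ u)) = (u, t) :=
    fun u hu => by rw [← hφ, φ.right_inv (hmem u hu)]
  set π : Coord (m + 1) →L[ℝ] Coord m :=
    ContinuousLinearMap.pi fun j => ContinuousLinearMap.proj (i.succAbove j)
  have hπψ : ∀ u ∈ U, π (ψ u) = u := fun u hu => congrArg Prod.fst (hinv u hu)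
  have hπd : ∀ u ∈ U, ∀ a, π (fderiv ℝ ψ u a) = a := by
    intro u hu a
    have h1 : HasFDerivAt (fun y => π (ψ y)) (π.comp (fderiv ℝ ψ u)) u :=
      π.hasFDerivAt.comp u (hψd u hu).hasFDerivAt
    have h2 : HasFDerivAt (fun y => π (ψ y)) (ContinuousLinearMap.id ℝ (Coord m)) u :=
      (hasFDerivAt_id u).congr_of_eventuallyEq (Filter.eventually_of_mem (hU.mem_nhds hu) hπψ)
    exact congrArg (fun L : Coord m →L[ℝ] Coord m => L a) (h1.unique h2)
  have htan : ∀ u ∈ U, ∀ a, fderiv ℝ (meanCurv X N) (ψ u) (fderiv ℝ ψ u a) = 0 := by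
    intro u hu a
    have hd := differentiableAt_of_contDiffOn hX.isOpen hX.contDiffOn_meanCurv (hψr u hu).1
    have h1 : HasFDerivAt (fun y => meanCurv X N (ψ y))
        ((fderiv ℝ (meanCurv X N) (ψ u)).comp (fderiv ℝ ψ u)) u :=
      hd.hasFDerivAt.comp u (hψd u hu).hasFDerivAt
    have h2 : HasFDerivAt (fun y => meanCurv X N (ψ y)) (0 : Coord m →L[ℝ] ℝ) u :=
      (hasFDerivAt_const t u).congr_of_eventuallyEq (Filter.eventually_of_mem (hU.mem_nhds hu)
        fun y hy => congrArg Prod.snd (hinv y hy))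
    exact congrArg (fun L : Coord m →L[ℝ] ℝ => L a) (h1.unique h2)
  have hsurj : ∀ u ∈ U, ∀ v, fderiv ℝ (meanCurv X N) (ψ u) v = 0 →
      ∃ a, fderiv ℝ ψ u a = v := by
    intro u hu v hv
    refine ⟨π v, sub_eq_zero.1 ?_⟩
    set d := fderiv ℝ ψ u (π v) - v with hd
    have h1 : π d = 0 := by rw [hd, map_sub, hπd u hu, sub_self]
    have h2 : fderiv ℝ (meanCurv X N) (ψ u) d = 0 := by
      rw [hd, map_sub, htan u hu, hv, sub_self]
    have h3 : ∀ j, j ≠ i → d j = 0 := by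
      intro j hj
      obtain ⟨k, rfl⟩ := Fin.exists_succAbove_eq hj
      exact congrFun h1 k
    rw [fderiv_apply_eq_sum_pd, Finset.sum_eq_single i (fun j _ hj => by rw [h3 j hj, zero_smul])
      (fun hi => absurd (Finset.mem_univ _) hi), smul_eq_mul] at h2
    ext j
    by_cases hj : j = i
    · subst hj
      exact (mul_eq_zero.1 h2).resolve_right (hφi _ (hψsrc u hu))
    · exact h3 j hj
  refine ⟨⟨hU, ?_, ?_, ?_⟩, hX.hasFlatNormalBundle_of_levelSet hB hU hψs hψr htan hsurj⟩
  · exact hX.smooth.comp hψs fun u hu => (hψr u hu).1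
  · intro u hu
    rw [injective_iff_map_eq_zero]
    intro a ha
    have hd := differentiableAt_of_contDiffOn hX.isOpen hX.smooth (hψr u hu).1
    have h1 : HasFDerivAt (fun y => X (ψ y)) ((fderiv ℝ X (ψ u)).comp (fderiv ℝ ψ u)) u :=
      hd.hasFDerivAt.comp u (hψd u hu).hasFDerivAt
    rw [h1.fderiv] at ha
    have h2 : fderiv ℝ ψ u a = 0 :=
      hX.immersion _ (hψr u hu).1 (ha.trans (map_zero _).symm)
    rw [← hπd u hu a, h2, map_zero]
  · -- the leaf embeds into the domain, since `ψ` has the left inverse `π`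
    set j : U → O := fun u => ⟨ψ u, hφO (hψsrc u u.2)⟩
    have hj : Continuous j := (hψs.continuousOn.domRestrict).subtype_mk _
    have h1 : (π ∘ ((↑) : O → Coord (m + 1))) ∘ j = ((↑) : U → Coord m) := funext fun u => hπψ u u.2
    have h2 : IsEmbedding j := by
      refine IsEmbedding.of_comp hj (π.continuous.comp continuous_subtype_val) ?_
      rw [h1]
      exact IsEmbedding.subtypeVal
    exact hemb.comp h2

/-! ### The rank at regular points -/

theorem IsHypersurface.isCMC_of_regularSet_eq_empty (hX : IsHypersurface Ω X N)
    (h : ¬ (regularSet Ω X N).Nonempty) : IsCMC Ω X N := by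
  refine hX.isOpen.exists_is_const_of_fderiv_eq_zero hX.isConnected.isPreconnected
    (hX.contDiffOn_meanCurv.differentiableOn (by simp)) fun x hx => ?_
  by_contra hne
  exact h ⟨x, hx, hne⟩

/-- The rank is upper semicontinuous, hence locally constant where it is smallest in a small
open set; there it is one. -/
theorem IsHypersurface.regularSet_subset_closure (hX : IsHypersurface Ω X N)
    (hB : IsBiconservative Ω X N) :
    regularSet Ω X N ⊆ closure {x | x ∈ regularSet Ω X N ∧ ∀ᶠ y in 𝓝 x, rankAt X N y = 1} := by
  intro p hp
  rw [mem_closure_iff]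
  intro W hW hpW
  set S := W ∩ regularSet Ω X N
  have hS : IsOpen S := hW.inter hX.isOpen_regularSet
  obtain ⟨q, hqS, hq⟩ : ∃ q ∈ S, ∀ y ∈ S, rankAt X N q ≤ rankAt X N y := by
    have hne : S.Nonempty := ⟨p, hpW, hp⟩
    exact ⟨Function.argminOn (rankAt X N) S hne, Function.argminOn_mem _ _ _,
      fun y hy => Function.argminOn_le _ _ hy⟩
  have hconst : ∀ᶠ y in 𝓝 q, rankAt X N y = rankAt X N q := by
    filter_upwards [hX.eventually_rankAt_le hqS.2.1, hS.mem_nhds hqS] with y hy hyS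
    exact le_antisymm hy (hq y hyS)
  refine ⟨q, hqS.1, hqS.2, ?_⟩
  have h1 := hX.rankAt_eq_one hB hqS.2 hconst
  filter_upwards [hconst] with y hy
  rw [hy, h1]

theorem IsHypersurface.isCMC_of_hasRank (hX : IsHypersurface Ω X N)
    (hB : IsBiconservative Ω X N) {k : ℕ} (hk : HasRank Ω X N k) (hk1 : k ≠ 1) :
    IsCMC Ω X N := by
  refine hX.isCMC_of_regularSet_eq_empty ?_
  rintro ⟨p, hp⟩
  refine hk1 ?_
  rw [← hk p hp.1]
  refine hX.rankAt_eq_one hB hp ?_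
  filter_upwards [hX.isOpen.mem_nhds hp.1] with y hy
  rw [hk y hy, hk p hp.1]

/-! ### Curves orthogonal to the level sets -/

theorem IsHypersurface.isOrthogonalCurve_of_isGradientCurve (hX : IsHypersurface Ω X N)
    {γ : ℝ → Coord n} {a b : ℝ} (hγ : ∀ t ∈ Ioo a b, γ t ∈ regularSet Ω X N)
    (h : IsGradientCurve X N γ a b) : IsOrthogonalCurve X N γ a b := by
  intro t ht
  rw [(h t ht).deriv]
  exact ⟨hX.grad_ne_zero (hγ t ht).1 (hγ t ht).2, fun w hw => by
    rw [hX.metric_grad (hγ t ht).1, hw]⟩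

/-- A vector orthogonal to the kernel of `df` is a multiple of the gradient of `f`. -/
theorem IsHypersurface.exists_eq_smul_grad (hX : IsHypersurface Ω X N) {x : Coord n}
    (hx : x ∈ Ω) {f : Coord n → ℝ} (hf : fderiv ℝ f x ≠ 0) {v : Coord n}
    (hv : ∀ w, fderiv ℝ f x w = 0 → metric X x v w = 0) : ∃ c : ℝ, v = c • grad X f x := by
  set u := grad X f x with hu
  obtain ⟨c, huw⟩ := hX.exists_metric_sub_smul_eq_zero hx (hX.grad_ne_zero hx hf) v
  rw [← hu] at huw
  refine ⟨c, ?_⟩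
  set w := v - c • u with hw
  have hvw := hv w (by rw [← hX.metric_grad hx, ← hu, huw])
  by_contra hne
  have hww := hX.metric_pos hx (sub_ne_zero.2 hne)
  rw [← hw] at hww
  have : metric X x w w = metric X x v w - c * metric X x u w := by
    simp only [metric]
    conv_lhs => rw [hw]
    rw [← hw, map_sub, map_smul, inner_sub_left, real_inner_smul_left]
  rw [hvw, huw, mul_zero, sub_zero] at this
  exact hww.ne' this

theorem IsHypersurface.deriv_eq_smul_grad_of_isOrthogonalCurve (hX : IsHypersurface Ω X N)
    {γ : ℝ → Coord n} {a b : ℝ} (hγ : ∀ t ∈ Ioo a b, γ t ∈ regularSet Ω X N)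
    (h : IsOrthogonalCurve X N γ a b) {t : ℝ} (ht : t ∈ Ioo a b) :
    ∃ c : ℝ, c ≠ 0 ∧ deriv γ t = c • grad X (meanCurv X N) (γ t) := by
  obtain ⟨c, hc⟩ := hX.exists_eq_smul_grad (hγ t ht).1 (hγ t ht).2 (h t ht).2
  refine ⟨c, ?_, hc⟩
  rintro rfl
  exact (h t ht).1 (by rw [hc, zero_smul])

/-! ### Principal frames -/

/-- At a regular point with locally constant rank the value `- n h / 2` is a simple principal
curvature in every principal frame: `∇h` has a nonzero coefficient at some `eᵢ`, whose principal
curvature is then `- n h / 2`, and the eigenspace is a line. -/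
theorem IsHypersurface.exists_principal_index (hX : IsHypersurface Ω X N)
    (hB : IsBiconservative Ω X N) {p : Coord n} (hp : p ∈ regularSet Ω X N)
    (hconst : ∀ᶠ y in 𝓝 p, rankAt X N y = rankAt X N p) {e : Fin n → Coord n} {l : Fin n → ℝ}
    (he : IsPrincipalFrame X N p e l) :
    ∃ i, l i = specialCurv X N p ∧
      e i ∈ Submodule.span ℝ {grad X (meanCurv X N) p} ∧
      ∀ j, j ≠ i → l j ≠ specialCurv X N p := by
  set u := grad X (meanCurv X N) p with hu
  have hu0 : u ≠ 0 := hX.grad_ne_zero hp.1 hp.2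
  have hmem : ∀ i, l i = specialCurv X N p → ∃ c : ℝ, c • u = e i := by
    intro i hi
    refine hX.exists_smul_grad_eq hB hp hconst ?_
    rw [shapeSub_apply, he.2 i, hi, sub_self]
  have hself : ∀ i, metric X p u (e i) * (l i - specialCurv X N p) = 0 := by
    intro i
    have h1 := hX.metric_shape hp.1 u (e i)
    rw [hX.shape_mulVec_grad hB hp.1, he.2 i, ← hu] at h1
    simp only [metric, map_smul, real_inner_smul_left, real_inner_smul_right] at h1 ⊢
    linarith
  -- the frame is a basis, so `∇h` is not orthogonal to all of it
  obtain ⟨i, hi⟩ : ∃ i, metric X p u (e i) ≠ 0 := by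
    by_contra! hne
    have hli : LinearIndependent ℝ e := by
      rw [Fintype.linearIndependent_iff]
      intro g hg i
      have h1 : metric X p (e i) (∑ j, g j • e j) = 0 := by rw [hg, metric, map_zero,
        inner_zero_right]
      have h2 : metric X p (e i) (∑ j, g j • e j) = ∑ j, g j * metric X p (e i) (e j) := by
        simp only [metric, map_sum, map_smul, inner_sum, real_inner_smul_right]
      rw [h2] at h1
      simpa [he.1] using h1
    have hspan := hli.span_eq_top_of_card_eq_finrank' (by simp)
    have hu_mem : u ∈ Submodule.span ℝ (range e) := hspan ▸ Submodule.mem_top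
    obtain ⟨g, hg⟩ := (Submodule.mem_span_range_iff_exists_fun ℝ).1 hu_mem
    have h3 : metric X p u (∑ j, g j • e j) = 0 := by
      have h4 : metric X p u (∑ j, g j • e j) = ∑ j, g j * metric X p u (e j) := by
        simp only [metric, map_sum, map_smul, inner_sum, real_inner_smul_right]
      rw [h4]
      exact Finset.sum_eq_zero fun j _ => by rw [hne j, mul_zero]
    rw [hg] at h3
    exact (hX.metric_pos hp.1 hu0).ne' h3
  have hli : l i = specialCurv X N p :=
    sub_eq_zero.1 ((mul_eq_zero.1 (hself i)).resolve_left hi)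
  obtain ⟨c, hc⟩ := hmem i hli
  refine ⟨i, hli, Submodule.mem_span_singleton.2 ⟨c, hc⟩, fun j hj hlj => ?_⟩
  obtain ⟨d, hd⟩ := hmem j hlj
  have hii := he.1 i i
  have hjj := he.1 j j
  have hij := he.1 i j
  rw [if_pos rfl, ← hc] at hii
  rw [if_pos rfl, ← hd] at hjj
  rw [if_neg hj.symm, ← hc, ← hd] at hij
  simp only [metric, map_smul, real_inner_smul_left, real_inner_smul_right] at hii hjj hij
  have hsq : ∀ q : ℝ, c * (c * q) * (d * (d * q)) = (d * (c * q)) ^ 2 := fun q => by ring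
  have h1 := hsq (inner ℝ (fderiv ℝ X p u) (fderiv ℝ X p u))
  rw [hii, hjj, hij] at h1
  norm_num at h1

end Hypersurface

theorem mainTheorem5 (n : ℕ) (Ω : Set (Hypersurface.Coord n))
    (X N : Hypersurface.Coord n → Hypersurface.Euc (n + 1))
    (hX : Hypersurface.IsHypersurface Ω X N)
    (hB : Hypersurface.IsBiconservative Ω X N) :
    -- rank zero forces constant mean curvature
    (Hypersurface.HasRank Ω X N 0 → Hypersurface.IsCMC Ω X N) ∧
    -- a hypersurface that has a rank is either CMC, or proper of rank one
    (∀ k : ℕ, Hypersurface.HasRank Ω X N k →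
      Hypersurface.IsCMC Ω X N ∨
        (Hypersurface.IsProperBiconservative Ω X N ∧ k = 1)) ∧
    -- without constancy of the rank: in the proper case there are regular points of `h`,
    -- and the rank is one on an open dense set of them
    (Hypersurface.IsProperBiconservative Ω X N →
      (Hypersurface.regularSet Ω X N).Nonempty ∧
      Hypersurface.regularSet Ω X N ⊆
        closure {x | x ∈ Hypersurface.regularSet Ω X N ∧
          ∀ᶠ y in 𝓝 x, Hypersurface.rankAt X N y = 1}) ∧
    -- the foliation near regular points
    (∀ p ∈ Hypersurface.regularSet Ω X N, Hypersurface.IsFoliatedByLevelSetsAt Ω X N p) ∧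
    -- the curves orthogonal to the leaves
    (∀ (γ : ℝ → Hypersurface.Coord n) (a b : ℝ),
      (∀ t ∈ Ioo a b, γ t ∈ Hypersurface.regularSet Ω X N) →
      (Hypersurface.IsGradientCurve X N γ a b → Hypersurface.IsOrthogonalCurve X N γ a b) ∧
      (Hypersurface.IsOrthogonalCurve X N γ a b →
        (∀ t ∈ Ioo a b, ∃ c : ℝ, c ≠ 0 ∧
          deriv γ t = c • Hypersurface.grad X (Hypersurface.meanCurv X N) (γ t)) ∧
        Hypersurface.IsCurvatureLine X N γ a b
          (fun t => Hypersurface.specialCurv X N (γ t)))) ∧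
    -- no other principal curvature takes the value `- n h / 2`, where the rank is locally constant
    (∀ p ∈ Hypersurface.regularSet Ω X N,
      (∀ᶠ y in 𝓝 p, Hypersurface.rankAt X N y = Hypersurface.rankAt X N p) →
      Hypersurface.rankAt X N p = 1 ∧
      ∀ (e : Fin n → Hypersurface.Coord n) (l : Fin n → ℝ),
        Hypersurface.IsPrincipalFrame X N p e l →
        ∃ i, l i = Hypersurface.specialCurv X N p ∧
          e i ∈ Submodule.span ℝ {Hypersurface.grad X (Hypersurface.meanCurv X N) p} ∧
          ∀ j, j ≠ i → l j ≠ Hypersurface.specialCurv X N p) := by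
  refine ⟨fun h0 => hX.isCMC_of_hasRank hB h0 zero_ne_one, fun k hk => ?_, fun hP => ?_,
    fun p hp => hX.isFoliatedByLevelSetsAt hB hp, fun γ a b hγ => ⟨fun h =>
      hX.isOrthogonalCurve_of_isGradientCurve hγ h, fun h => ⟨fun t ht =>
        hX.deriv_eq_smul_grad_of_isOrthogonalCurve hγ h ht, fun t ht => ⟨(h t ht).1, ?_⟩⟩⟩,
    fun p hp hconst => ⟨hX.rankAt_eq_one hB hp hconst, fun e l he =>
      hX.exists_principal_index hB hp hconst he⟩⟩
  · by_cases hC : Hypersurface.IsCMC Ω X N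
    · exact Or.inl hC
    · refine Or.inr ⟨⟨hB, hC⟩, ?_⟩
      by_contra hk1
      exact hC (hX.isCMC_of_hasRank hB hk hk1)
  · refine ⟨?_, hX.regularSet_subset_closure hB⟩
    by_contra hne
    exact hP.2 (hX.isCMC_of_regularSet_eq_empty hne)
  · obtain ⟨c, -, hc⟩ := hX.deriv_eq_smul_grad_of_isOrthogonalCurve hγ h ht
    rw [hc, Matrix.mulVec_smul, hX.shape_mulVec_grad hB (hγ t ht).1, smul_comm]
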